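/- **Theorem 5.** For permutations $x,y$ of $[d]=\{1,\dots,d\}$ let $\Delta(x,y)=d-|\mathrm{LCS}(x,y)|$ be the Ulam distance, where $\mathrm{LCS}(x,y)$ is a longest common subsequence of the sequences $x(1),\dots,x(d)$ and $y(1),\dots,y(d)$. For permutations $x_1,\dots,x_n$ of $[d]$, a permutation $\tilde y$ of $[d]$ is a $c$-approximate ($1$-)median if $\sum_{i=1}^n\Delta(x_i,\tilde y)\le c\cdot\min_{y}\sum_{i=1}^n\Delta(x_i,y)$, where the minimum is over all permutations $y$ of $[d]$. There is a randomized one-pass streaming algorithm that, given $n\ge 2$, $d\ge 2$ and a stream of $n$ permutations $x_1,\dots,x_n$ of $[d]$, always halts, uses $O(d\log d\,\log^2 n)$ bits of space, and outputs a $1.9999$-approximate median of $x_1,\dots,x_n$ with probability at least $1-\delta$. Here $\delta\in(0,1)$ is any fixed constant failure probability; the algorithm and the constant in the $O(\cdot)$ may depend on $\delta$, but not on $n$, $d$ or the input. The algorithm is a program of a random access machine that reads the stream once, symbol by symbol, and flips fair coins; its space is the maximum, over the whole computation, of the total bit length of the addresses and contents of all its nonzero memory cells. -/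

import Mathlib

/-! ### Permutations and the Ulam metric -/

/-- A permutation `x` of `[d] = {1, …, d}`, written out as the sequence `x(1), x(2), …, x(d)`. -/
def permWord {d : ℕ} (x : Equiv.Perm (Fin d)) : List ℕ :=
  List.ofFn fun i => (x i : ℕ) + 1

/-- The length of a longest common subsequence of two sequences. -/
noncomputable def lcsLength (u v : List ℕ) : ℕ :=
  sSup {m : ℕ | ∃ w : List ℕ, w.Sublist u ∧ w.Sublist v ∧ w.length = m}

/-- The Ulam distance `Δ(x, y) = d - |LCS(x, y)|`. -/
noncomputable def ulamDist {d : ℕ} (x y : Equiv.Perm (Fin d)) : ℕ :=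
  d - lcsLength (permWord x) (permWord y)

/-- The median objective value of `y` for the input permutations `x 0, …, x (n - 1)`. -/
noncomputable def medianObj {n d : ℕ} (x : Fin n → Equiv.Perm (Fin d))
    (y : Equiv.Perm (Fin d)) : ℕ :=
  ∑ i, ulamDist (x i) y

/-- The optimal (1-)median objective value, over all permutations of `[d]`
(a minimum, since there are finitely many of them and at least one). -/
noncomputable def medianOpt {n d : ℕ} (x : Fin n → Equiv.Perm (Fin d)) : ℕ :=
  ⨅ y, medianObj x y

/-- `y` is a `c`-approximate (1-)median of the input permutations. -/
def IsApproxMedian {n d : ℕ} (c : ℝ) (x : Fin n → Equiv.Perm (Fin d))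
    (y : Equiv.Perm (Fin d)) : Prop :=
  (medianObj x y : ℝ) ≤ c * (medianOpt x : ℝ)

/-! ### Randomized one-pass streaming machines

A random access machine over cells holding natural numbers, with direct and indirect addressing,
a one-way read-only input tape (the stream), a one-way write-only output tape, and a coin-flip
instruction. Its working memory is measured in bits by the logarithmic space cost:
every cell in use pays the bit length of its address plus the bit length of its contents.
The stream, the output tape and the coins are not stored; whatever the machine wants to remember
of them, and all the workspace of its computation, has to be in memory and is charged. -/

namespace StreamRAM

/-- Arithmetic operations; `sub` is truncated subtraction, `div` and `mod` are division with
remainder (with `a / 0 = 0` and `a % 0 = a`). -/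
inductive Arith
  | add
  | sub
  | mul
  | div
  | mod

def Arith.eval : Arith → ℕ → ℕ → ℕ
  | .add, a, b => a + b
  | .sub, a, b => a - b
  | .mul, a, b => a * b
  | .div, a, b => a / b
  | .mod, a, b => a % b

/-- Elementary instructions. Below, `M[a]` is the content of the cell with address `a`. -/
inductive Instr
  /-- `M[a] := v` -/
  | const (a v : ℕ)
  /-- `M[a] := M[b] ∘ M[c]` -/
  | arith (o : Arith) (a b c : ℕ)
  /-- `M[a] := M[M[b]]` -/
  | load (a b : ℕ)
  /-- `M[M[a]] := M[b]` -/
  | store (a b : ℕ)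
  /-- `M[a] :=` the next symbol of the stream, or `0` at the end of the stream -/
  | read (a : ℕ)
  /-- `M[a] :=` a fresh fair coin flip, `0` or `1` -/
  | flip (a : ℕ)
  /-- append `M[a]` to the output -/
  | write (a : ℕ)

/-- Programs: finite sequences of instructions with branching and loops. -/
inductive Prog
  | instr (i : Instr)
  | seq (p q : Prog)
  /-- if `M[a] ≠ 0` then `p` else `q` -/
  | cond (a : ℕ) (p q : Prog)
  /-- while `M[a] ≠ 0` do `p` -/
  | loop (a : ℕ) (p : Prog)

/-- A configuration. All but finitely many cells hold `0`, and those are not in use. -/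
structure Config where
  mem : ℕ →₀ ℕ
  /-- the part of the stream that has not been read yet -/
  input : List ℕ
  /-- what has been written so far -/
  output : List ℕ
  /-- the number of coins flipped so far -/
  flips : ℕ

/-- The number of bits of working memory in use: for every cell holding a nonzero value, the bit
length of its address plus the bit length of its contents. -/
def Config.space (s : Config) : ℕ :=
  s.mem.sum fun a v => Nat.size a + Nat.size v

noncomputable def Config.set (s : Config) (a v : ℕ) : Config :=
  { s with mem := s.mem.update a v }

/-- The effect of one instruction, where `ω` is the sequence of coin flips. -/
noncomputable def Instr.step (ω : ℕ → Bool) (s : Config) : Instr → Config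
  | .const a v => s.set a v
  | .arith o a b c => s.set a (o.eval (s.mem b) (s.mem c))
  | .load a b => s.set a (s.mem (s.mem b))
  | .store a b => s.set (s.mem a) (s.mem b)
  | .read a => { s.set a (s.input.headD 0) with input := s.input.tail }
  | .flip a => { s.set a (ω s.flips).toNat with flips := s.flips + 1 }
  | .write a => { s with output := s.output ++ [s.mem a] }

/-- `Exec ω p s t m`: with the coin flips `ω`, the program `p` started in the configuration `s`
halts in the configuration `t`, and `m` is the maximum number of bits of working memory in use
over all configurations that it passes through, `s` and `t` included. -/
inductive Exec (ω : ℕ → Bool) : Prog → Config → Config → ℕ → Prop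
  | instr (i : Instr) (s : Config) :
      Exec ω (.instr i) s (i.step ω s) (max s.space (i.step ω s).space)
  | seq {p q : Prog} {s t u : Config} {m k : ℕ} :
      Exec ω p s t m → Exec ω q t u k → Exec ω (.seq p q) s u (max m k)
  | cond_true {a : ℕ} {p q : Prog} {s t : Config} {m : ℕ} :
      s.mem a ≠ 0 → Exec ω p s t m → Exec ω (.cond a p q) s t m
  | cond_false {a : ℕ} {p q : Prog} {s t : Config} {m : ℕ} :
      s.mem a = 0 → Exec ω q s t m → Exec ω (.cond a p q) s t m
  | loop_done {a : ℕ} {p : Prog} {s : Config} :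
      s.mem a = 0 → Exec ω (.loop a p) s s s.space
  | loop_step {a : ℕ} {p : Prog} {s t u : Config} {m k : ℕ} :
      s.mem a ≠ 0 → Exec ω p s t m → Exec ω (.loop a p) t u k →
        Exec ω (.loop a p) s u (max m k)

/-- The initial configuration on the stream `x 0, …, x (n - 1)` of permutations of `[d]`: the
parameters `n` and `d` are in the cells `0` and `1`, all other cells are empty, and the
permutations are on the input tape one after another, symbol by symbol. -/
noncomputable def Config.init {n d : ℕ} (x : Fin n → Equiv.Perm (Fin d)) : Config where
  mem := Finsupp.single 0 n + Finsupp.single 1 d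
  input := (List.ofFn fun i => permWord (x i)).flatten
  output := []
  flips := 0

/-- The law of an infinite sequence of independent fair coin flips. -/
noncomputable def coinMeasure : MeasureTheory.Measure (ℕ → Bool) :=
  MeasureTheory.Measure.infinitePi fun _ => (PMF.uniformOfFintype Bool).toMeasure

end StreamRAM

/-!
# Streaming approximation of the Ulam median

Time is not bounded, so the algorithm may search exhaustively; what matters is that a constant
number of permutations, each written as a number below `d ^ d`, suffices as working memory.

**The median of five.** Let `z` be an optimal median, and let the inputs be sampled uniformly. The
expected cost of a random input `x` as a median is `2 R` minus the expected defect of the triangle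
inequality `Δ(x, x') ≤ Δ(x, z) + Δ(z, x')`, where `R` is the cost of `z`. If the defect is large, a
random input is a good median. If it is small, the sets of symbols that have to be moved between `z`
and the various inputs are nearly disjoint, and then every median `y` of five random inputs is close
to `z` (`UlamMedian.ulamDist_le_of_sum_le`): the sets of symbols moved between `y` and the five
inputs are nearly disjoint, too; and if `y` and `z` order the symbols `a, b` differently, then for
each of the five inputs one of `a, b` lies in one of its two sets, so that one of these four cases
occurs for two inputs, and their sets overlap. Hence the better of a random input and the median of
five random inputs has expected cost at most `41 / 21 * R` (`UlamMedian.sum_min_totalDist_le`).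

**Amplification.** Among `K` independent groups of five samples, one yields a candidate of cost at
most `1.99 R` except with probability `0.99 ^ K`. The difference of the distances of a random input
from two candidates is bounded by the distance of the candidates, which is at most the sum of their
mean distances from the inputs, so by Chebyshev's inequality constantly many further samples
tell a candidate of cost more than `1.999 R` from one of cost at most `1.99 R`
(`UlamMedian.card_selection_fails_le`). The remaining slack up to `1.9999` pays for drawing indices
as `n + 20` random bits modulo `n`.

**The machine.** Arithmetic terms with bounded sums express all of the exhaustive search: bounded
quantifiers and bounded minimization are sums of indicators. Terms are compiled to programs once and
for all (`StreamRAM.Term.wp_compile`), with polynomially bounded intermediate values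
(`StreamRAM.Term.exists_fits`), hence with `O(d log d + log n)` bits in each of constantly many
cells. The program itself is then verified with weakest preconditions
(`StreamRAM.runs_program`).
-/

namespace StreamRAM

/-! ### Space-bounded execution of programs -/

/-- All cells in use have addresses below `A` and contents at most `V`. -/
def Config.Bdd (A V : ℕ) (s : Config) : Prop :=
  ∀ a, s.mem a ≤ V ∧ (s.mem a ≠ 0 → a < A)

/-- An upper bound for the space of a configuration satisfying `Config.Bdd A V`. -/
def spaceBound (A V : ℕ) : ℕ := A * (A.size + V.size)

theorem Config.Bdd.space_le {A V : ℕ} {s : Config} (h : s.Bdd A V) :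
    s.space ≤ spaceBound A V := by
  have hsub : s.mem.support ⊆ Finset.range A := fun a ha =>
    Finset.mem_range.2 ((h a).2 (Finsupp.mem_support_iff.1 ha))
  calc s.space = ∑ a ∈ s.mem.support, (Nat.size a + Nat.size (s.mem a)) := rfl
    _ ≤ ∑ a ∈ s.mem.support, (A.size + V.size) := Finset.sum_le_sum fun a ha =>
        Nat.add_le_add (Nat.size_le_size (Finset.mem_range.1 (hsub ha)).le)
          (Nat.size_le_size (h a).1)
    _ ≤ ∑ a ∈ Finset.range A, (A.size + V.size) :=
        Finset.sum_le_sum_of_subset hsub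
    _ = spaceBound A V := by simp [spaceBound]

@[simp] theorem Config.set_mem (s : Config) (a v b : ℕ) :
    (s.set a v).mem b = if b = a then v else s.mem b := by
  simp [Config.set, Finsupp.coe_update, Function.update_apply]

theorem Config.Bdd.set {A V : ℕ} {s : Config} (h : s.Bdd A V) {a v : ℕ} (ha : a < A)
    (hv : v ≤ V) : (s.set a v).Bdd A V := by
  intro b
  rw [Config.set_mem]
  split_ifs with hb
  · exact ⟨hv, fun _ => hb ▸ ha⟩
  · exact h b

/-- Weakest precondition: started in `s`, the program halts in a configuration satisfying `Q`,
and every configuration on the way respects the space bound. -/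
def WP (A V : ℕ) (ω : ℕ → Bool) (p : Prog) (Q : Config → Prop) (s : Config) : Prop :=
  ∃ t m, Exec ω p s t m ∧ m ≤ spaceBound A V ∧ t.Bdd A V ∧ Q t

section WP

variable {A V : ℕ} {ω : ℕ → Bool} {Q : Config → Prop} {s : Config}

theorem wp_instr {i : Instr} (hs : s.Bdd A V) (ht : (i.step ω s).Bdd A V)
    (hQ : Q (i.step ω s)) : WP A V ω (.instr i) Q s :=
  ⟨_, _, .instr i s, max_le hs.space_le ht.space_le, ht, hQ⟩

theorem wp_seq {p q : Prog} (h : WP A V ω p (fun t => t.Bdd A V → WP A V ω q Q t) s) :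
    WP A V ω (.seq p q) Q s := by
  obtain ⟨t, m, e, hm, ht, hq⟩ := h
  obtain ⟨u, k, e', hk, hu, hQ⟩ := hq ht
  exact ⟨u, _, .seq e e', max_le hm hk, hu, hQ⟩

theorem WP.mono {p : Prog} {R : Config → Prop} (h : WP A V ω p R s)
    (hR : ∀ t, t.Bdd A V → R t → Q t) : WP A V ω p Q s := by
  obtain ⟨t, m, e, hm, ht, hr⟩ := h
  exact ⟨t, m, e, hm, ht, hR t ht hr⟩

theorem wp_const {a v : ℕ} (hs : s.Bdd A V) (ha : a < A) (hv : v ≤ V) (hQ : Q (s.set a v)) :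
    WP A V ω (.instr (.const a v)) Q s :=
  wp_instr hs (hs.set ha hv) hQ

theorem wp_arith {o : Arith} {a b c : ℕ} (hs : s.Bdd A V) (ha : a < A)
    (hv : o.eval (s.mem b) (s.mem c) ≤ V) (hQ : Q (s.set a (o.eval (s.mem b) (s.mem c)))) :
    WP A V ω (.instr (.arith o a b c)) Q s :=
  wp_instr hs (hs.set ha hv) hQ

theorem wp_write {a : ℕ} (hs : s.Bdd A V) (hQ : Q { s with output := s.output ++ [s.mem a] }) :
    WP A V ω (.instr (.write a)) Q s :=
  wp_instr hs hs hQ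

/-- Rule for loops: `I j` holds when exactly `j` more rounds are to come. -/
theorem wp_loop {c : ℕ} {p : Prog} (I : ℕ → Config → Prop)
    (hstep : ∀ j s, s.Bdd A V → I (j + 1) s → s.mem c ≠ 0 ∧ WP A V ω p (I j) s)
    (hdone : ∀ s, s.Bdd A V → I 0 s → s.mem c = 0 ∧ Q s) (N : ℕ) :
    ∀ s, s.Bdd A V → I N s → WP A V ω (.loop c p) Q s := by
  induction N with
  | zero =>
    intro s hs h
    obtain ⟨h0, hQ⟩ := hdone s hs h
    exact ⟨s, _, .loop_done h0, hs.space_le, hs, hQ⟩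
  | succ N ih =>
    intro s hs h
    obtain ⟨h0, t, m, e, hm, ht, hI⟩ := hstep N s hs h
    obtain ⟨u, k, e', hk, hu, hQ⟩ := ih t ht hI
    exact ⟨u, _, .loop_step h0 e e', max_le hm hk, hu, hQ⟩

end WP

/-- The two configurations agree on the tapes and on the number of coins flipped. -/
def Config.SameTapes (s t : Config) : Prop :=
  t.input = s.input ∧ t.output = s.output ∧ t.flips = s.flips

theorem Config.SameTapes.rfl {s : Config} : s.SameTapes s := ⟨Eq.refl _, Eq.refl _, Eq.refl _⟩

theorem Config.SameTapes.trans {s t u : Config} (h : s.SameTapes t) (h' : t.SameTapes u) :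
    s.SameTapes u :=
  ⟨h'.1.trans h.1, h'.2.1.trans h.2.1, h'.2.2.trans h.2.2⟩

theorem Config.SameTapes.set {s t : Config} (h : s.SameTapes t) (a v : ℕ) :
    s.SameTapes (t.set a v) := h

/-- `M[a] := M[b]`, for `a ≠ b`. -/
def copyProg (a b : ℕ) : Prog :=
  .seq (.instr (.const a 0)) (.instr (.arith .add a b a))

theorem wp_copy {A V : ℕ} {ω : ℕ → Bool} {Q : Config → Prop} {s : Config} {a b : ℕ}
    (hs : s.Bdd A V) (hab : a ≠ b) (ha : a < A)
    (hQ : ∀ t, (∀ c, t.mem c = if c = a then s.mem b else s.mem c) → s.SameTapes t → Q t) :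
    WP A V ω (copyProg a b) Q s := by
  refine wp_seq (wp_const hs ha (Nat.zero_le _) fun h1 => ?_)
  have e : Arith.add.eval ((s.set a 0).mem b) ((s.set a 0).mem a) = s.mem b := by
    simp [Arith.eval, hab.symm]
  refine wp_arith h1 ha ?_ ?_
  · rw [e]; exact (hs b).1
  · rw [e]
    refine hQ _ (fun c => ?_) .rfl
    by_cases hc : c = a <;> simp [hc]

/-! ### Terms and their compilation -/

/-- Arithmetic terms whose variables are memory cells. -/
inductive Term
  | const (c : ℕ)
  | var (a : ℕ)
  | arith (o : Arith) (t u : Term)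
  /-- the term `t / u ^ w` -/
  | shift (t u w : Term)
  /-- the sum of `u` over all values `< t` of the variable `v` -/
  | sum (v : ℕ) (t u : Term)

namespace Term

/-- The value of a term, where `ρ` gives the values of the variables. -/
def eval : Term → (ℕ → ℕ) → ℕ
  | const c, _ => c
  | var a, ρ => ρ a
  | arith o t u, ρ => o.eval (t.eval ρ) (u.eval ρ)
  | shift t u w, ρ => t.eval ρ / u.eval ρ ^ w.eval ρ
  | sum v t u, ρ => ∑ i ∈ Finset.range (t.eval ρ), u.eval (Function.update ρ v i)

/-- All values that arise in the evaluation of the term are at most `V`. -/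
def Fits (V : ℕ) : Term → (ℕ → ℕ) → Prop
  | const c, _ => c ≤ V
  | var a, ρ => ρ a ≤ V
  | arith o t u, ρ => t.Fits V ρ ∧ u.Fits V ρ ∧ o.eval (t.eval ρ) (u.eval ρ) ≤ V
  | shift t u w, ρ => t.Fits V ρ ∧ u.Fits V ρ ∧ w.Fits V ρ
  | sum v t u, ρ => t.Fits V ρ ∧
      ∑ i ∈ Finset.range (t.eval ρ), u.eval (Function.update ρ v i) ≤ V ∧
      ∀ i < t.eval ρ, u.Fits V (Function.update ρ v i)

/-- All variables of the term, free or bound, are cells with addresses below `k`. -/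
def Below (k : ℕ) : Term → Prop
  | const _ => True
  | var a => a < k
  | arith _ t u => t.Below k ∧ u.Below k
  | shift t u w => t.Below k ∧ u.Below k ∧ w.Below k
  | sum v t u => v < k ∧ t.Below k ∧ u.Below k

/-- The number of consecutive scratch cells that suffice for the evaluation of the term. -/
def width : Term → ℕ
  | const _ => 1
  | var _ => 1
  | arith _ t u => t.width + u.width + 1
  | shift t u w => t.width + u.width + w.width + 4
  | sum _ t u => t.width + u.width + 4

theorem Below.mono {k l : ℕ} (h : k ≤ l) : ∀ {t : Term}, t.Below k → t.Below l
  | const _, _ => trivial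
  | var _, h' => lt_of_lt_of_le h' h
  | arith _ _ _, h' => ⟨h'.1.mono h, h'.2.mono h⟩
  | shift _ _ _, h' => ⟨h'.1.mono h, h'.2.1.mono h, h'.2.2.mono h⟩
  | sum _ _ _, h' => ⟨lt_of_lt_of_le h'.1 h, h'.2.1.mono h, h'.2.2.mono h⟩

theorem eval_congr {k : ℕ} : ∀ {t : Term} {ρ σ : ℕ → ℕ}, t.Below k → (∀ a < k, ρ a = σ a) →
    t.eval ρ = t.eval σ
  | const _, _, _, _, _ => rfl
  | var _, _, _, h, e => e _ h
  | arith _ _ _, _, _, h, e => by simp only [eval, eval_congr h.1 e, eval_congr h.2 e]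
  | shift _ _ _, _, _, h, e => by
    simp only [eval, eval_congr h.1 e, eval_congr h.2.1 e, eval_congr h.2.2 e]
  | sum v t u, ρ, σ, h, e => by
    simp only [eval, eval_congr h.2.1 e]
    refine Finset.sum_congr rfl fun i _ => eval_congr h.2.2 fun a ha => ?_
    simp only [Function.update_apply, e a ha]

theorem Fits.congr {V k : ℕ} : ∀ {t : Term} {ρ σ : ℕ → ℕ}, t.Fits V ρ → t.Below k →
    (∀ a < k, ρ a = σ a) → t.Fits V σ
  | const _, _, _, f, _, _ => f
  | var _, _, _, f, h, e => by simpa only [Fits, ← e _ h] using f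
  | arith _ _ _, _, _, f, h, e => by
    refine ⟨f.1.congr h.1 e, f.2.1.congr h.2 e, ?_⟩
    rw [← eval_congr h.1 e, ← eval_congr h.2 e]; exact f.2.2
  | shift _ _ _, _, _, f, h, e => ⟨f.1.congr h.1 e, f.2.1.congr h.2.1 e, f.2.2.congr h.2.2 e⟩
  | sum v t u, ρ, σ, f, h, e => by
    have e' : ∀ i, ∀ a < k, Function.update ρ v i a = Function.update σ v i a := fun i a ha => by
      simp only [Function.update_apply, e a ha]
    refine ⟨f.1.congr h.2.1 e, ?_, fun i hi => ?_⟩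
    · rw [← eval_congr h.2.1 e]
      refine le_trans (le_of_eq (Finset.sum_congr rfl fun i _ => ?_)) f.2.1
      exact (eval_congr h.2.2 (e' i)).symm
    · rw [← eval_congr h.2.1 e] at hi
      exact (f.2.2 i hi).congr h.2.2 (e' i)

theorem Fits.eval_le {V : ℕ} : ∀ {t : Term} {ρ : ℕ → ℕ}, t.Fits V ρ → t.eval ρ ≤ V
  | const _, _, f => f
  | var _, _, f => f
  | arith _ _ _, _, f => f.2.2
  | shift _ _ _, _, f => (Nat.div_le_self _ _).trans f.1.eval_le
  | sum _ _ _, _, f => f.2.1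

/-- A program that writes the value of the term into cell `k`, using scratch cells from `k` on. -/
def compile : Term → ℕ → Prog
  | const c, k => .instr (.const k c)
  | var a, k => copyProg k a
  | arith o t u, k =>
      .seq (t.compile k) (.seq (u.compile (k + 1)) (.instr (.arith o k k (k + 1))))
  | shift t u w, k =>
      .seq (t.compile k) (.seq (u.compile (k + 1)) (.seq (w.compile (k + 2))
        (.loop (k + 2) (.seq (.instr (.arith .div k k (k + 1)))
          (.seq (.instr (.const (k + 3) 1)) (.instr (.arith .sub (k + 2) (k + 2) (k + 3))))))))
  | sum v t u, k =>
      -- cell `k` counts down, `k + 1` saves the old value of `v`, `k + 2` accumulates the sum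
      .seq (t.compile k) (.seq (copyProg (k + 1) v) (.seq (.instr (.const v 0))
        (.seq (.instr (.const (k + 2) 0))
        (.seq
          (.loop k (.seq (u.compile (k + 3))
            (.seq (.instr (.arith .add (k + 2) (k + 2) (k + 3)))
            (.seq (.instr (.const (k + 3) 1))
            (.seq (.instr (.arith .add v v (k + 3)))
              (.instr (.arith .sub k k (k + 3))))))))
          (.seq (copyProg v (k + 1)) (copyProg k (k + 2)))))))

/-- Correctness of `Term.compile`: cells below `k` keep their contents. -/
theorem wp_compile {A V : ℕ} {ω : ℕ → Bool} (hV : 1 ≤ V) :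
    ∀ (t : Term) (k : ℕ) (s : Config) (Q : Config → Prop), t.Below k → k + t.width ≤ A →
      s.Bdd A V → t.Fits V s.mem →
      (∀ s', (∀ a < k, s'.mem a = s.mem a) → s'.mem k = t.eval s.mem → s.SameTapes s' → Q s') →
      WP A V ω (t.compile k) Q s
  | const c, k, s, Q, _, hA, hs, hf, hQ => by
    refine wp_const hs (by simp only [width] at hA; omega) hf (hQ _ (fun a ha => ?_) ?_ .rfl)
    · simp [ha.ne]
    · simp [eval]
  | var a, k, s, Q, hb, hA, hs, hf, hQ => by
    have hb : a < k := hb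
    refine wp_copy hs hb.ne' (by simp only [width] at hA; omega) fun t ht hio => hQ _ ?_ ?_ hio
    · intro c hc; simp [ht, hc.ne]
    · simp [ht, eval]
  | arith o t u, k, s, Q, hb, hA, hs, hf, hQ => by
    simp only [width] at hA
    refine wp_seq (wp_compile hV t k s _ hb.1 (by omega) hs hf.1 fun s1 h1 h1k io1 b1 => ?_)
    have hfu := hf.2.1.congr hb.2 fun a ha => (h1 a ha).symm
    refine wp_seq (wp_compile hV u (k + 1) s1 _ (hb.2.mono (by omega)) (by omega) b1 hfu
      fun s2 h2 h2k io2 b2 => ?_)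
    have e : o.eval (s2.mem k) (s2.mem (k + 1)) = o.eval (t.eval s.mem) (u.eval s.mem) := by
      rw [h2 k (by omega), h1k, h2k, eval_congr hb.2 h1]
    refine wp_arith b2 (by omega) (by rw [e]; exact hf.2.2) (hQ _ (fun a ha => ?_) ?_ ?_)
    · simp [ha.ne, h2 a (by omega), h1 a ha]
    · rw [e]; simp [eval]
    · exact (io1.trans io2).set _ _
  | shift t u w, k, s, Q, hb, hA, hs, hf, hQ => by
    simp only [width] at hA
    refine wp_seq (wp_compile hV t k s _ hb.1 (by omega) hs hf.1 fun s1 h1 h1k io1 b1 => ?_)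
    have hfu := hf.2.1.congr hb.2.1 fun a ha => (h1 a ha).symm
    refine wp_seq (wp_compile hV u (k + 1) s1 _ (hb.2.1.mono (by omega)) (by omega) b1 hfu
      fun s2 h2 h2k io2 b2 => ?_)
    have h12 : ∀ a < k, s2.mem a = s.mem a := fun a ha => by rw [h2 a (by omega), h1 a ha]
    have hfw := hf.2.2.congr hb.2.2 fun a ha => (h12 a ha).symm
    refine wp_seq (wp_compile hV w (k + 2) s2 _ (hb.2.2.mono (by omega)) (by omega) b2 hfw
      fun s3 h3 h3k io3 b3 => ?_)
    have h13 : ∀ a < k, s3.mem a = s.mem a := fun a ha => by rw [h3 a (by omega), h12 a ha]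
    rw [eval_congr hb.2.2 h12] at h3k
    rw [eval_congr hb.2.1 h1] at h2k
    set N := w.eval s.mem with hN
    refine wp_loop (fun j s' => (∀ a < k, s'.mem a = s.mem a) ∧ s'.mem (k + 1) = u.eval s.mem ∧
      s'.mem (k + 2) = j ∧ s.SameTapes s' ∧
      ∃ i, i + j = N ∧ s'.mem k = t.eval s.mem / u.eval s.mem ^ i) ?_ ?_ N s3 b3 ?_
    · rintro j s' bs ⟨g1, g2, g3, gio, i, hij, gk⟩
      refine ⟨by omega, wp_seq (wp_arith bs (by omega) ?_ fun b4 => wp_seq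
        (wp_const b4 (by omega) hV fun b5 => wp_arith b5 (by omega) ?_ ?_))⟩
      · exact (Nat.div_le_self _ _).trans (bs k).1
      · exact (Nat.sub_le _ _).trans (b5 _).1
      · refine ⟨fun a ha => ?_, ?_, ?_, gio, i + 1, by omega, ?_⟩
        · rw [← g1 a ha]; simp [show a ≠ k by omega, show a ≠ k + 2 by omega,
            show a ≠ k + 3 by omega]
        · simp [g2]
        · simp [g3, Arith.eval]
        · simp [gk, g2, Arith.eval, Nat.div_div_eq_div_mul, pow_succ]
    · rintro s' bs ⟨g1, g2, g3, gio, i, hij, gk⟩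
      refine ⟨g3, hQ _ g1 ?_ gio⟩
      rw [gk, eval, ← hN, ← hij, add_zero]
    · refine ⟨h13, by rw [h3 _ (by omega), h2k], h3k, (io1.trans io2).trans io3, 0, by omega, ?_⟩
      rw [h3 _ (by omega), h2 _ (by omega), h1k]; simp
  | sum v t u, k, s, Q, hb, hA, hs, hf, hQ => by
    simp only [width] at hA
    have hv : v < k := hb.1
    refine wp_seq (wp_compile hV t k s _ hb.2.1 (by omega) hs hf.1 fun s1 h1 h1k io1 b1 => ?_)
    refine wp_seq (wp_copy b1 (by omega) (by omega) fun s2 h2 io2 b2 => ?_)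
    refine wp_seq (wp_const b2 (by omega) (Nat.zero_le _) fun b3 => ?_)
    refine wp_seq (wp_const b3 (by omega) (Nat.zero_le _) fun b4 => ?_)
    set N := t.eval s.mem with hN
    set f : ℕ → ℕ := fun i => u.eval (Function.update s.mem v i) with hfdef
    have hsum : ∑ i ∈ Finset.range N, f i ≤ V := hf.2.1
    refine wp_seq (wp_loop (fun j s' => (∀ a < k, a ≠ v → s'.mem a = s.mem a) ∧ s'.mem k = j ∧
      s'.mem (k + 1) = s.mem v ∧ s.SameTapes s' ∧ ∃ i, i + j = N ∧ s'.mem v = i ∧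
      s'.mem (k + 2) = ∑ i ∈ Finset.range i, f i) ?_ ?_ N _ b4 ?_)
    · rintro j s' bs ⟨g1, gk, gk1, gio, i, hij, gv, gk2⟩
      have hup : ∀ a < k, Function.update s.mem v i a = s'.mem a := fun a ha => by
        by_cases hav : a = v
        · simp [hav, gv]
        · simp [hav, g1 a ha hav]
      have hfu := (hf.2.2 i (by omega)).congr hb.2.2 hup
      refine ⟨by omega, wp_seq (wp_compile hV u (k + 3) s' _ (hb.2.2.mono (by omega)) (by omega)
        bs hfu fun s5 h5 h5k io5 b5 => ?_)⟩
      rw [← eval_congr hb.2.2 hup] at h5k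
      have hle : ∑ i ∈ Finset.range (i + 1), f i ≤ V :=
        (Finset.sum_le_sum_of_subset (Finset.range_mono (by omega))).trans hsum
      have e5 : Arith.add.eval (s5.mem (k + 2)) (s5.mem (k + 3)) =
          ∑ i ∈ Finset.range (i + 1), f i := by
        rw [h5 _ (by omega), gk2, h5k, Finset.sum_range_succ]; rfl
      refine wp_seq (wp_arith b5 (by omega) (by rw [e5]; exact hle) fun b6 => ?_)
      refine wp_seq (wp_const b6 (by omega) hV fun b7 => ?_)
      have h5v : s5.mem v = i := by rw [h5 _ (by omega), gv]
      have hNV : N ≤ V := hf.1.eval_le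
      refine wp_seq (wp_arith b7 (by omega) ?_ fun b8 => ?_)
      · simp [Arith.eval, show v ≠ k + 2 by omega, show v ≠ k + 3 by omega, h5v]; omega
      refine wp_arith b8 (by omega) ((Nat.sub_le _ _).trans (b8 _).1) ?_
      refine ⟨fun a ha hav => ?_, ?_, ?_, gio.trans io5, i + 1, by omega, ?_, ?_⟩
      · rw [← g1 a ha hav, ← h5 a (by omega)]
        simp [hav, show a ≠ k by omega, show a ≠ k + 2 by omega, show a ≠ k + 3 by omega]
      · simp [Arith.eval, show k ≠ v by omega, show k + 3 ≠ v by omega, h5 k (by omega), gk]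
      · simp [show k + 1 ≠ v by omega, h5 (k + 1) (by omega), gk1]
      · simp [Arith.eval, show v ≠ k by omega, show v ≠ k + 2 by omega,
          show v ≠ k + 3 by omega, h5v]
      · rw [e5]; simp [show k + 2 ≠ v by omega]
    · rintro s' bs ⟨g1, gk, gk1, gio, i, hij, gv, gk2⟩
      refine ⟨gk, fun _ => wp_seq (wp_copy bs (by omega) (by omega) fun s6 h6 io6 b6 =>
        wp_copy b6 (by omega) (by omega) fun s7 h7 io7 => hQ _ (fun a ha => ?_) ?_
          ((gio.trans io6).trans io7))⟩
      · rw [h7, if_neg ha.ne, h6]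
        split_ifs with hav
        · rw [gk1, hav]
        · exact g1 a ha hav
      · rw [h7, if_pos rfl, h6, if_neg (by omega), gk2, eval, show i = N by omega]
    · refine ⟨fun a ha hav => ?_, ?_, ?_, io1.trans io2, 0, by omega, ?_, ?_⟩
      · simp [hav, h2, show a ≠ k + 1 by omega, show a ≠ k + 2 by omega, h1 a ha]
      · simp [h2, show k ≠ v by omega, h1k]
      · simp [h2, show k + 1 ≠ v by omega, h1 v hv]
      · simp [show v ≠ k + 2 by omega]
      · simp

theorem arith_eval_le (o : Arith) {a b B : ℕ} (hB : 2 ≤ B) {e f : ℕ} (ha : a ≤ B ^ e)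
    (hb : b ≤ B ^ f) : o.eval a b ≤ B ^ (e + f + 1) := by
  have h1 : 1 ≤ B ^ e := Nat.one_le_pow _ _ (by omega)
  have h2 : 1 ≤ B ^ f := Nat.one_le_pow _ _ (by omega)
  have hmul : B ^ (e + f + 1) = B ^ e * B ^ f * B := by ring
  have h3 : B ^ e * B ^ f * 2 ≤ B ^ (e + f + 1) := by rw [hmul]; gcongr
  have h4 : a ≤ B ^ e * B ^ f := ha.trans (Nat.le_mul_of_pos_right _ h2)
  have h5 : b ≤ B ^ e * B ^ f := hb.trans (Nat.le_mul_of_pos_left _ h1)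
  cases o with
  | add => simp only [Arith.eval]; omega
  | sub => simp only [Arith.eval]; omega
  | mul => simp only [Arith.eval]; have := Nat.mul_le_mul ha hb; omega
  | div => simp only [Arith.eval]; have := Nat.div_le_self a b; omega
  | mod => simp only [Arith.eval]; have := Nat.mod_le a b; omega

/-- The values of a term are polynomially bounded in the values of its variables. -/
theorem exists_fits : ∀ t : Term, ∃ e : ℕ, ∀ B : ℕ, 2 ≤ B → ∀ ρ : ℕ → ℕ, (∀ a, ρ a ≤ B) →
    ∀ V, B ^ e ≤ V → t.Fits V ρ ∧ t.eval ρ ≤ B ^ e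
  | const c => ⟨c, fun B hB ρ _ V hV => by
      have : c ≤ B ^ c := (Nat.lt_pow_self (by omega)).le
      exact ⟨this.trans hV, this⟩⟩
  | var a => ⟨1, fun B hB ρ h V hV => by
      have : ρ a ≤ B ^ 1 := by simpa using h a
      exact ⟨this.trans hV, this⟩⟩
  | arith o t u => by
    obtain ⟨e, he⟩ := exists_fits t
    obtain ⟨f, hf⟩ := exists_fits u
    refine ⟨e + f + 1, fun B hB ρ h V hV => ?_⟩
    have hm : ∀ g, g ≤ e + f + 1 → B ^ g ≤ V := fun g hg =>
      (Nat.pow_le_pow_right (by omega) hg).trans hV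
    obtain ⟨t1, t2⟩ := he B hB ρ h V (hm _ (by omega))
    obtain ⟨u1, u2⟩ := hf B hB ρ h V (hm _ (by omega))
    have := arith_eval_le o hB t2 u2
    exact ⟨⟨t1, u1, this.trans hV⟩, this⟩
  | shift t u w => by
    obtain ⟨e, he⟩ := exists_fits t
    obtain ⟨f, hf⟩ := exists_fits u
    obtain ⟨g, hg⟩ := exists_fits w
    refine ⟨e + f + g, fun B hB ρ h V hV => ?_⟩
    have hm : ∀ i, i ≤ e + f + g → B ^ i ≤ V := fun i hi =>
      (Nat.pow_le_pow_right (by omega) hi).trans hV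
    obtain ⟨t1, t2⟩ := he B hB ρ h V (hm _ (by omega))
    obtain ⟨u1, u2⟩ := hf B hB ρ h V (hm _ (by omega))
    obtain ⟨w1, w2⟩ := hg B hB ρ h V (hm _ (by omega))
    exact ⟨⟨t1, u1, w1⟩, ((Nat.div_le_self _ _).trans t2).trans
      (Nat.pow_le_pow_right (by omega) (by omega))⟩
  | sum v t u => by
    obtain ⟨e, he⟩ := exists_fits t
    obtain ⟨f, hf⟩ := exists_fits u
    refine ⟨e + (e + 1) * f, fun B hB ρ h V hV => ?_⟩
    have hm : ∀ i, i ≤ e + (e + 1) * f → B ^ i ≤ V := fun i hi =>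
      (Nat.pow_le_pow_right (by omega) hi).trans hV
    obtain ⟨t1, t2⟩ := he B hB ρ h V (hm _ (by omega))
    have hBe : B ≤ B ^ (e + 1) := Nat.le_self_pow (by omega) B
    have hu : ∀ i < t.eval ρ, u.Fits V (Function.update ρ v i) ∧
        u.eval (Function.update ρ v i) ≤ B ^ ((e + 1) * f) := fun i hi => by
      have := hf (B ^ (e + 1)) (hB.trans hBe) (Function.update ρ v i) (fun a => ?_) V
        (by rw [← pow_mul]; exact hm _ (by omega))
      · rwa [← pow_mul] at this
      · rw [Function.update_apply]
        split_ifs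
        · exact (hi.le.trans t2).trans (Nat.pow_le_pow_right (by omega) (by omega))
        · exact (h a).trans hBe
    have hs : ∑ i ∈ Finset.range (t.eval ρ), u.eval (Function.update ρ v i) ≤
        B ^ (e + (e + 1) * f) := by
      refine (Finset.sum_le_card_nsmul _ _ _ fun i hi => (hu i (Finset.mem_range.1 hi)).2).trans ?_
      rw [Finset.card_range, smul_eq_mul, pow_add]
      exact Nat.mul_le_mul_right _ t2
    exact ⟨⟨t1, hs.trans hV, fun i hi => (hu i hi).1⟩, hs⟩

end Term

end StreamRAM

namespace UlamMedian

open Equiv (Perm)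

variable {d : ℕ}

/-! ### The Ulam distance in terms of sets of symbols -/

/-- The permutations `x` and `y`, read as sequences, list the symbols of `S` in the same order. -/
def Agree (x y : Perm (Fin d)) (S : Finset (Fin d)) : Prop :=
  ∀ a ∈ S, ∀ b ∈ S, x.symm a < x.symm b → y.symm a < y.symm b

theorem Agree.mono {x y : Perm (Fin d)} {S T : Finset (Fin d)} (h : Agree x y T) (hST : S ⊆ T) :
    Agree x y S :=
  fun a ha b hb => h a (hST ha) b (hST hb)

theorem Agree.symm {x y : Perm (Fin d)} {S : Finset (Fin d)} (h : Agree x y S) :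
    Agree y x S := by
  intro a ha b hb hab
  by_contra hc
  rcases (not_lt.1 hc).lt_or_eq with h1 | h1
  · exact lt_asymm hab (h b hb a ha h1)
  · rw [x.symm.injective h1] at hab
    exact lt_irrefl _ hab

theorem Agree.trans {x y z : Perm (Fin d)} {S : Finset (Fin d)} (h : Agree x y S)
    (h' : Agree y z S) : Agree x z S :=
  fun a ha b hb hab => h' a ha b hb (h a ha b hb hab)

theorem pairwise_ofFn_perm (x : Perm (Fin d)) :
    (List.ofFn x).Pairwise fun a b => x.symm a < x.symm b := by
  rw [List.pairwise_ofFn]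
  intro i j hij
  simpa using hij

theorem permWord_eq_map (x : Perm (Fin d)) :
    permWord x = (List.ofFn x).map fun a : Fin d => (a : ℕ) + 1 := by
  simp [permWord, List.map_ofFn, Function.comp_def]

/-- The common subsequences of the words of two permutations correspond to the sets of symbols
that the two permutations list in the same order. -/
theorem exists_common_sublist_iff (x y : Perm (Fin d)) (m : ℕ) :
    (∃ w : List ℕ, w.Sublist (permWord x) ∧ w.Sublist (permWord y) ∧ w.length = m) ↔
      ∃ S : Finset (Fin d), Agree x y S ∧ S.card = m := by
  have hinj : Function.Injective fun a : Fin d => (a : ℕ) + 1 := fun a b h => by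
    simpa [Fin.ext_iff] using h
  constructor
  · rintro ⟨w, hx, hy, hm⟩
    rw [permWord_eq_map, List.sublist_map_iff] at hx hy
    obtain ⟨u, hu, rfl⟩ := hx
    obtain ⟨v, hv, huv⟩ := hy
    obtain rfl := List.map_injective_iff.2 hinj huv
    have hux := (pairwise_ofFn_perm x).sublist hu
    have huy := (pairwise_ofFn_perm y).sublist hv
    refine ⟨u.toFinset, fun a ha b hb hab => ?_, ?_⟩
    · rw [List.mem_toFinset, List.mem_iff_getElem] at ha hb
      obtain ⟨i, hi, rfl⟩ := ha
      obtain ⟨j, hj, rfl⟩ := hb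
      rw [List.pairwise_iff_getElem] at hux huy
      rcases lt_trichotomy i j with h | h | h
      · exact huy i j hi hj h
      · subst h; exact absurd hab (lt_irrefl _)
      · exact absurd hab (lt_asymm (hux j i hj hi h))
    · rw [List.toFinset_card_of_nodup, ← hm, List.length_map]
      exact hux.imp fun h => fun e => by rw [e] at h; exact lt_irrefl _ h
  · rintro ⟨S, hS, hm⟩
    have hnd : ∀ z : Perm (Fin d), (List.ofFn z).Nodup := fun z =>
      List.nodup_ofFn.2 z.injective
    have hmem : ∀ (z : Perm (Fin d)) a, a ∈ List.ofFn z := fun z a =>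
      (List.mem_ofFn' _ _).2 ⟨z.symm a, by simp⟩
    have hfil : (List.ofFn x).filter (· ∈ S) = (List.ofFn y).filter (· ∈ S) := by
      have hp : ((List.ofFn x).filter (· ∈ S)).Perm ((List.ofFn y).filter (· ∈ S)) :=
        (List.perm_ext_iff_of_nodup ((hnd x).filter _) ((hnd y).filter _)).2 fun a => by
          simp [List.mem_filter, -List.mem_ofFn, hmem]
      refine hp.eq_of_pairwise (le := fun a b => y.symm a < y.symm b)
        (fun a b _ _ h h' => absurd h' (lt_asymm h)) ?_ ?_
      · refine ((pairwise_ofFn_perm x).filter _).imp_of_mem fun ha hb hab => ?_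
        rw [List.mem_filter] at ha hb
        exact hS _ (by simpa using ha.2) _ (by simpa using hb.2) hab
      · exact (pairwise_ofFn_perm y).filter _
    refine ⟨((List.ofFn x).filter (· ∈ S)).map fun a : Fin d => (a : ℕ) + 1, ?_, ?_, ?_⟩
    · rw [permWord_eq_map]
      exact List.filter_sublist.map _
    · rw [permWord_eq_map, hfil]
      exact List.filter_sublist.map _
    · rw [List.length_map, ← hm, ← List.toFinset_card_of_nodup ((hnd x).filter _)]
      congr 1
      ext a
      simp [-List.mem_ofFn, hmem]

/-- `Δ(x, y)` is at most `m` iff the removal of at most `m` symbols makes `x` and `y` agree. -/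
theorem ulamDist_le_iff (x y : Perm (Fin d)) (m : ℕ) :
    ulamDist x y ≤ m ↔ ∃ T : Finset (Fin d), Agree x y Tᶜ ∧ T.card ≤ m := by
  have hset : {m : ℕ | ∃ w : List ℕ, w.Sublist (permWord x) ∧ w.Sublist (permWord y) ∧
      w.length = m} = {m | ∃ S : Finset (Fin d), Agree x y S ∧ S.card = m} :=
    Set.ext fun m => exists_common_sublist_iff x y m
  have hbdd : BddAbove {m | ∃ S : Finset (Fin d), Agree x y S ∧ S.card = m} :=
    ⟨d, by rintro _ ⟨S, _, rfl⟩; simpa using S.card_le_univ⟩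
  have hne : {m | ∃ S : Finset (Fin d), Agree x y S ∧ S.card = m}.Nonempty :=
    ⟨0, ∅, by simp [Agree], rfl⟩
  rw [ulamDist, lcsLength, hset]
  constructor
  · intro h
    obtain ⟨S, hS, hc⟩ := Nat.sSup_mem hne hbdd
    refine ⟨Sᶜ, by simpa using hS, ?_⟩
    rw [Finset.card_compl, Fintype.card_fin, hc]
    exact h
  · rintro ⟨T, hT, hc⟩
    have := le_csSup hbdd ⟨Tᶜ, hT, rfl⟩
    rw [Finset.card_compl, Fintype.card_fin] at this
    omega

theorem exists_agree_compl (x y : Perm (Fin d)) :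
    ∃ T : Finset (Fin d), Agree x y Tᶜ ∧ T.card = ulamDist x y := by
  obtain ⟨T, hT, hc⟩ := (ulamDist_le_iff x y _).1 le_rfl
  exact ⟨T, hT, hc.antisymm ((ulamDist_le_iff x y _).2 ⟨T, hT, le_rfl⟩)⟩

theorem ulamDist_le_card {x y : Perm (Fin d)} {T : Finset (Fin d)} (h : Agree x y Tᶜ) :
    ulamDist x y ≤ T.card :=
  (ulamDist_le_iff x y _).2 ⟨T, h, le_rfl⟩

theorem ulamDist_comm (x y : Perm (Fin d)) : ulamDist x y = ulamDist y x := by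
  have h : ∀ x y : Perm (Fin d), ulamDist y x ≤ ulamDist x y := fun x y => by
    obtain ⟨T, hT, hc⟩ := exists_agree_compl x y
    exact hc ▸ ulamDist_le_card hT.symm
  exact (h y x).antisymm (h x y)

theorem ulamDist_triangle (x y z : Perm (Fin d)) :
    ulamDist x z ≤ ulamDist x y + ulamDist y z := by
  obtain ⟨S, hS, hc⟩ := exists_agree_compl x y
  obtain ⟨T, hT, hc'⟩ := exists_agree_compl y z
  rw [← hc, ← hc']
  refine (ulamDist_le_card (T := S ∪ T) ?_).trans (Finset.card_union_le _ _)
  rw [Finset.compl_union]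
  exact (hS.mono Finset.inter_subset_left).trans (hT.mono Finset.inter_subset_right)

theorem ulamDist_le_self (x y : Perm (Fin d)) : ulamDist x y ≤ d :=
  Nat.sub_le _ _

/-! ### Medians of five permutations -/

/-- The ten pairs of indices of five permutations. -/
def pairs : Finset (Fin 5 × Fin 5) := Finset.univ.filter fun p => p.1 < p.2

theorem sum_pairs (f : Fin 5 → ℝ) : ∑ p ∈ pairs, (f p.1 + f p.2) = 4 * ∑ s, f s := by
  simp only [pairs, Finset.sum_filter, Fintype.sum_prod_type, Fin.sum_univ_five]
  simp [Fin.lt_def]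
  ring

theorem card_pairs : pairs.card = 10 := by decide

/-- **Rigidity.** If `y` is at least as good a median of five permutations as `z`, then `y` is
close to `z`, unless the triangle inequalities through `z` are far from tight. If `I s` and `J s`
are the symbols moved between `x s` and `z` and between `x s` and `y`, then for every pair `a, b`
that `y` and `z` order differently, each of the five `s` has `a` or `b` in `I s` or in `J s`; so one
of the four cases occurs for two values of `s`. Hence the overlaps of the `I s` and those of the
`J s` cover all differences between `y` and `z`, and the overlaps are bounded by the defects of the
triangle inequalities. -/
theorem ulamDist_le_of_sum_le (x : Fin 5 → Perm (Fin d)) (y z : Perm (Fin d))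
    (h : ∑ s, ulamDist (x s) y ≤ ∑ s, ulamDist (x s) z) :
    (ulamDist y z : ℝ) ≤ 2 * ∑ p ∈ pairs,
      ((ulamDist (x p.1) z : ℝ) + ulamDist (x p.2) z - ulamDist (x p.1) (x p.2)) := by
  choose I hI hIc using fun s => exists_agree_compl (x s) z
  choose J hJ hJc using fun s => exists_agree_compl (x s) y
  set T := pairs.biUnion fun p => I p.1 ∩ I p.2 ∪ J p.1 ∩ J p.2 with hT
  have hmemT : ∀ a, a ∉ T → ∀ s t, s ≠ t → ¬ (a ∈ I s ∧ a ∈ I t) ∧ ¬ (a ∈ J s ∧ a ∈ J t) := by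
    intro a ha s t hst
    have key : ∀ s t : Fin 5, s < t → ¬ (a ∈ I s ∧ a ∈ I t) ∧ ¬ (a ∈ J s ∧ a ∈ J t) := by
      intro s t hst
      constructor <;> refine fun hc => ha (Finset.mem_biUnion.2 ⟨(s, t), ?_, ?_⟩)
      · simpa [pairs] using hst
      · simp [hc.1, hc.2]
      · simpa [pairs] using hst
      · simp [hc.1, hc.2]
    rcases lt_or_gt_of_ne hst with h1 | h1
    · exact key s t h1
    · have := key t s h1
      tauto
  have hag : Agree y z Tᶜ := by
    intro a ha b hb hab
    rw [Finset.mem_compl] at ha hb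
    by_contra hz
    have hne : a ≠ b := fun e => by rw [e] at hab; exact lt_irrefl _ hab
    have hcase : ∀ s, ∃ c : Fin 4, (c = 0 → a ∈ I s) ∧ (c = 1 → b ∈ I s) ∧ (c = 2 → a ∈ J s) ∧
        (c = 3 → b ∈ J s) := by
      intro s
      by_contra hno
      push Not at hno
      have h0 : a ∉ I s := fun h => by simpa [h] using hno 0
      have h1 : b ∉ I s := fun h => by simpa [h] using hno 1
      have h2 : a ∉ J s := fun h => by simpa [h] using hno 2
      have h3 : b ∉ J s := fun h => by simpa [h] using hno 3
      rcases lt_or_gt_of_ne ((x s).symm.injective.ne hne) with hlt | hlt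
      · exact hz (hI s a (by simpa using h0) b (by simpa using h1) hlt)
      · exact lt_asymm hab (hJ s b (by simpa using h3) a (by simpa using h2) hlt)
    choose c hc using hcase
    obtain ⟨s, t, hst, hcs⟩ := Fintype.exists_ne_map_eq_of_card_lt c (by simp)
    have hs := hc s
    have ht := hc t
    rw [← hcs] at ht
    have ha' := hmemT a ha s t hst
    have hb' := hmemT b hb s t hst
    generalize c s = k at hs ht
    fin_cases k <;> simp at hs ht <;> tauto
  have hcard : (T.card : ℝ) ≤ ∑ p ∈ pairs, (((I p.1 ∩ I p.2).card : ℝ) + (J p.1 ∩ J p.2).card) := by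
    rw [hT]
    refine le_trans (Nat.cast_le.2 Finset.card_biUnion_le) ?_
    push_cast
    exact Finset.sum_le_sum fun p _ => by exact_mod_cast Finset.card_union_le _ _
  have hov : ∀ (w : Perm (Fin d)) (I : Fin 5 → Finset (Fin d)),
      (∀ s, Agree (x s) w (I s)ᶜ) → (∀ s, (I s).card = ulamDist (x s) w) → ∀ s t,
      ((I s ∩ I t).card : ℝ) ≤ ulamDist (x s) w + ulamDist (x t) w - ulamDist (x s) (x t) := by
    intro w I hI hIc s t
    have h1 : ulamDist (x s) (x t) ≤ (I s ∪ I t).card := by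
      refine ulamDist_le_card ?_
      rw [Finset.compl_union]
      exact ((hI s).mono Finset.inter_subset_left).trans
        ((hI t).mono Finset.inter_subset_right).symm
    have h2 := Finset.card_union_add_card_inter (I s) (I t)
    rw [← hIc, ← hIc]
    have h1' : (ulamDist (x s) (x t) : ℝ) ≤ (I s ∪ I t).card := by exact_mod_cast h1
    have h2' : ((I s ∪ I t).card : ℝ) + (I s ∩ I t).card = (I s).card + (I t).card := by
      exact_mod_cast h2
    linarith
  have hsum : ∑ s, (ulamDist (x s) y : ℝ) ≤ ∑ s, (ulamDist (x s) z : ℝ) := by exact_mod_cast h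
  have hJs : ∑ p ∈ pairs, ((ulamDist (x p.1) y : ℝ) + ulamDist (x p.2) y) ≤
      ∑ p ∈ pairs, ((ulamDist (x p.1) z : ℝ) + ulamDist (x p.2) z) := by
    rw [sum_pairs fun s => (ulamDist (x s) y : ℝ), sum_pairs fun s => (ulamDist (x s) z : ℝ)]
    linarith
  calc (ulamDist y z : ℝ) ≤ T.card := by exact_mod_cast ulamDist_le_card hag
    _ ≤ _ := hcard
    _ ≤ ∑ p ∈ pairs, (((ulamDist (x p.1) z : ℝ) + ulamDist (x p.2) z -
          ulamDist (x p.1) (x p.2)) +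
        ((ulamDist (x p.1) y : ℝ) + ulamDist (x p.2) y - ulamDist (x p.1) (x p.2))) :=
      Finset.sum_le_sum fun p _ => add_le_add (hov z I hI hIc _ _) (hov y J hJ hJc _ _)
    _ ≤ _ := by
      simp only [Finset.sum_add_distrib, Finset.sum_sub_distrib] at hJs ⊢
      linarith

end UlamMedian

namespace UlamMedian

open Equiv (Perm)

/-! ### Averages over independent samples -/

section Averages

variable {Ω : Type*} [Fintype Ω]

theorem sum_apply_eq {n : ℕ} (s : Fin (n + 1)) (g : Ω → ℝ) :
    ∑ τ : Fin (n + 1) → Ω, g (τ s) = (Fintype.card Ω : ℝ) ^ n * ∑ u, g u := by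
  rw [← (Fin.insertNthEquiv (fun _ => Ω) s).sum_comp, Fintype.sum_prod_type]
  simp [Finset.mul_sum]

theorem sum_apply₂_eq {n : ℕ} {s t : Fin (n + 2)} (hst : s ≠ t) (g : Ω → Ω → ℝ) :
    ∑ τ : Fin (n + 2) → Ω, g (τ s) (τ t) = (Fintype.card Ω : ℝ) ^ n * ∑ u, ∑ v, g u v := by
  obtain ⟨t', rfl⟩ := Fin.exists_succAbove_eq hst.symm
  rw [← (Fin.insertNthEquiv (fun _ => Ω) s).sum_comp, Fintype.sum_prod_type]
  simp only [Fin.insertNthEquiv_apply, Fin.insertNth_apply_same, Fin.insertNth_apply_succAbove]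
  rw [Finset.mul_sum]
  exact Finset.sum_congr rfl fun u _ => sum_apply_eq t' (g u)

/-- The second moment of a sum of independent centred variables. -/
theorem sum_sq_sum_eq (w : Ω → ℝ) (hw : ∑ u, w u = 0) (k : ℕ) :
    ∑ T : Fin k → Ω, (∑ j, w (T j)) ^ 2 * Fintype.card Ω =
      k * (Fintype.card Ω : ℝ) ^ k * ∑ u, w u ^ 2 := by
  induction k with
  | zero => simp
  | succ k ih =>
    rw [← (Fin.consEquiv fun _ => Ω).sum_comp, Fintype.sum_prod_type]
    have e : ∀ (u : Ω) (T : Fin k → Ω),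
        (∑ j, w ((Fin.consEquiv fun _ => Ω) (u, T) j)) ^ 2 * (Fintype.card Ω : ℝ) =
        w u ^ 2 * Fintype.card Ω + w u * (2 * (∑ j, w (T j)) * Fintype.card Ω) +
          (∑ j, w (T j)) ^ 2 * Fintype.card Ω := fun u T => by
      simp only [Fin.consEquiv_apply, Fin.sum_univ_succ, Fin.cons_zero, Fin.cons_succ]
      ring
    simp only [e, Finset.sum_add_distrib]
    simp only [← Finset.mul_sum, ← Finset.sum_mul, ih, hw, zero_mul, Finset.sum_const,
      Finset.card_univ, Fintype.card_fun, Fintype.card_fin, nsmul_eq_mul]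
    push_cast
    ring

/-- Chebyshev's inequality: a variable with values in `[-D, D]` whose mean is at least `κ D > 0`
rarely has a nonpositive sum over `k` independent samples. -/
theorem card_sum_nonpos_le (Z : Ω → ℝ) {D κ : ℝ} (hκ : 0 < κ) (hD : 0 < D)
    (hZ : ∀ u, |Z u| ≤ D) (hmean : κ * D * Fintype.card Ω ≤ ∑ u, Z u) {k : ℕ} (hk : 0 < k)
    [DecidablePred fun T : Fin k → Ω => ∑ j, Z (T j) ≤ 0] :
    ((Finset.univ.filter fun T : Fin k → Ω => ∑ j, Z (T j) ≤ 0).card : ℝ) ≤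
      (Fintype.card Ω : ℝ) ^ k / (k * κ ^ 2) := by
  classical
  set M : ℝ := ((Fintype.card Ω : ℕ) : ℝ) with hM
  rcases isEmpty_or_nonempty Ω with hΩ | hΩ
  · have : IsEmpty (Fin k → Ω) := ⟨fun T => hΩ.elim (T ⟨0, hk⟩)⟩
    simp only [Finset.univ_eq_empty, Finset.filter_empty, Finset.card_empty, Nat.cast_zero]
    positivity
  have hMpos : 0 < M := by rw [hM]; exact_mod_cast Fintype.card_pos
  have hkpos : (0 : ℝ) < k := by exact_mod_cast hk
  set μ : ℝ := (∑ u, Z u) / M with hμ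
  have hμD : κ * D ≤ μ := by rw [hμ, le_div_iff₀ hMpos]; exact hmean
  have hμpos : 0 < μ := (mul_pos hκ hD).trans_le hμD
  have hcent : ∑ u, (Z u - μ) = 0 := by
    rw [Finset.sum_sub_distrib, Finset.sum_const, Finset.card_univ, nsmul_eq_mul, ← hM, hμ]
    field_simp
    ring
  have hvar : ∑ u, (Z u - μ) ^ 2 ≤ M * D ^ 2 := by
    have h1 : ∑ u, (Z u - μ) ^ 2 = ∑ u, Z u ^ 2 - M * μ ^ 2 := by
      have : ∀ u, (Z u - μ) ^ 2 = Z u ^ 2 - 2 * μ * (Z u - μ) - μ ^ 2 := fun u => by ring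
      rw [Finset.sum_congr rfl fun u _ => this u, Finset.sum_sub_distrib, Finset.sum_sub_distrib,
        ← Finset.mul_sum, hcent]
      simp [hM]
    have h2 : ∑ u, Z u ^ 2 ≤ ∑ _u : Ω, D ^ 2 :=
      Finset.sum_le_sum fun u _ => sq_le_sq' (abs_le.1 (hZ u)).1 (abs_le.1 (hZ u)).2
    rw [Finset.sum_const, Finset.card_univ, nsmul_eq_mul, ← hM] at h2
    have := mul_pos hMpos (pow_pos hμpos 2)
    linarith
  set B := Finset.univ.filter fun T : Fin k → Ω => ∑ j, Z (T j) ≤ 0 with hB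
  have hlow : ∀ T ∈ B, (k * (κ * D)) ^ 2 * M ≤ (∑ j, (Z (T j) - μ)) ^ 2 * M := by
    intro T hT
    have hT' : ∑ j, Z (T j) ≤ 0 := by simpa [hB] using hT
    have hs : ∑ j, (Z (T j) - μ) = ∑ j, Z (T j) - k * μ := by
      simp [Finset.sum_sub_distrib]
    have h3 : k * (κ * D) ≤ k * μ := by gcongr
    have h4 : 0 ≤ k * (κ * D) := by positivity
    refine mul_le_mul_of_nonneg_right ?_ hMpos.le
    rw [hs]
    nlinarith
  have h5 : (B.card : ℝ) * ((k * (κ * D)) ^ 2 * M) ≤ k * M ^ k * (M * D ^ 2) := by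
    calc (B.card : ℝ) * ((k * (κ * D)) ^ 2 * M) = ∑ _T ∈ B, (k * (κ * D)) ^ 2 * M := by simp
      _ ≤ ∑ T ∈ B, (∑ j, (Z (T j) - μ)) ^ 2 * M := Finset.sum_le_sum hlow
      _ ≤ ∑ T : Fin k → Ω, (∑ j, (Z (T j) - μ)) ^ 2 * M :=
        Finset.sum_le_sum_of_subset_of_nonneg (Finset.subset_univ _) fun T _ _ => by positivity
      _ = k * M ^ k * ∑ u, (Z u - μ) ^ 2 := sum_sq_sum_eq _ hcent k
      _ ≤ _ := by gcongr
  rw [le_div_iff₀ (by positivity)]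
  have h6 : 0 < k * M * D ^ 2 := by positivity
  refine le_of_mul_le_mul_right ?_ h6
  calc (B.card : ℝ) * (k * κ ^ 2) * (k * M * D ^ 2) = B.card * ((k * (κ * D)) ^ 2 * M) := by ring
    _ ≤ k * M ^ k * (M * D ^ 2) := h5
    _ = M ^ k * (k * M * D ^ 2) := by ring

/-- A form of Markov's inequality that also covers the mean zero. -/
theorem card_lt_le_of_sum_le {f : Ω → ℝ} (hf : ∀ u, 0 ≤ f u) {a b R : ℝ} (hb : 0 < b)
    (ha : 0 ≤ a) (hR : 0 ≤ R) (h : ∑ u, f u ≤ a * R * Fintype.card Ω)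
    [DecidablePred fun u => b * R < f u] :
    ((Finset.univ.filter fun u => b * R < f u).card : ℝ) ≤ a / b * Fintype.card Ω := by
  rcases hR.eq_or_lt with rfl | hR
  · have h0 : ∀ u, f u = 0 := fun u => by
      have := (Finset.sum_eq_zero_iff_of_nonneg fun u _ => hf u).1
        (le_antisymm (by simpa using h) (Finset.sum_nonneg fun u _ => hf u))
      exact this u (Finset.mem_univ u)
    simp only [h0, mul_zero, lt_irrefl, Finset.filter_false, Finset.card_empty, Nat.cast_zero]
    positivity
  · have h1 : ((Finset.univ.filter fun u => b * R < f u).card : ℝ) * (b * R) ≤ ∑ u, f u := by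
      calc _ = ∑ _u ∈ Finset.univ.filter fun u => b * R < f u, b * R := by simp
        _ ≤ ∑ u ∈ Finset.univ.filter fun u => b * R < f u, f u :=
          Finset.sum_le_sum fun u hu => (Finset.mem_filter.1 hu).2.le
        _ ≤ _ := Finset.sum_le_sum_of_subset_of_nonneg (Finset.subset_univ _) fun u _ _ => hf u
    rw [div_mul_eq_mul_div, le_div_iff₀ hb]
    refine le_of_mul_le_mul_right ?_ hR
    calc _ = ((Finset.univ.filter fun u => b * R < f u).card : ℝ) * (b * R) := by ring
      _ ≤ _ := h1.trans h
      _ = _ := by ring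

end Averages

/-! ### Medians of random samples -/

section Sampling

variable {d : ℕ} {Ω : Type*} [Fintype Ω]

/-- The sum of the Ulam distances from `y` to the members of the family `x`. -/
noncomputable def totalDist (x : Ω → Perm (Fin d)) (y : Perm (Fin d)) : ℕ := ∑ u, ulamDist (x u) y

theorem totalDist_le (x : Ω → Perm (Fin d)) (y z : Perm (Fin d)) :
    totalDist x y ≤ totalDist x z + Fintype.card Ω * ulamDist z y := by
  have : ∀ u, ulamDist (x u) y ≤ ulamDist (x u) z + ulamDist z y := fun u =>
    ulamDist_triangle _ _ _
  refine (Finset.sum_le_sum fun u _ => this u).trans (le_of_eq ?_)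
  simp [totalDist, Finset.sum_add_distrib]

/-- `med` selects a median of every five permutations. -/
def IsMedianFun (med : (Fin 5 → Perm (Fin d)) → Perm (Fin d)) : Prop :=
  ∀ x y, totalDist x (med x) ≤ totalDist x y

/-- Either a random member `x (τ 0)` of the family or the median of five random members is a good
median on average: the expected cost of the former falls short of `2 R` exactly by the expected
defect in the triangle inequalities through `z`, which by rigidity controls the latter. -/
theorem sum_min_totalDist_le (x : Ω → Perm (Fin d)) (z : Perm (Fin d))
    {med : (Fin 5 → Perm (Fin d)) → Perm (Fin d)} (hmed : IsMedianFun med) :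
    ∑ τ : Fin 5 → Ω, min (totalDist x (x (τ 0)) : ℝ) (totalDist x (med fun s => x (τ s))) ≤
      41 / 21 * totalDist x z * Fintype.card (Fin 5 → Ω) := by
  set M : ℝ := ((Fintype.card Ω : ℕ) : ℝ) with hM
  set R : ℝ := ((totalDist x z : ℕ) : ℝ) with hR
  set G : ℝ := ∑ u, (totalDist x (x u) : ℝ) with hG
  have hM0 : 0 ≤ M := by rw [hM]; positivity
  have hRsum : ∑ u, (ulamDist (x u) z : ℝ) = R := by rw [hR, totalDist]; push_cast; rfl
  have hGsum : ∑ u, ∑ v, (ulamDist (x u) (x v) : ℝ) = G := by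
    rw [Finset.sum_comm, hG]
    refine Finset.sum_congr rfl fun u _ => ?_
    rw [totalDist]; push_cast; rfl
  have hdef : ∑ τ : Fin 5 → Ω, ∑ p ∈ pairs, ((ulamDist (x (τ p.1)) z : ℝ) +
      ulamDist (x (τ p.2)) z - ulamDist (x (τ p.1)) (x (τ p.2))) =
      10 * (2 * M ^ 4 * R - M ^ 3 * G) := by
    rw [Finset.sum_comm]
    have : ∀ p ∈ pairs, ∑ τ : Fin 5 → Ω, ((ulamDist (x (τ p.1)) z : ℝ) +
        ulamDist (x (τ p.2)) z - ulamDist (x (τ p.1)) (x (τ p.2))) =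
        2 * M ^ 4 * R - M ^ 3 * G := fun p hp => by
      have hne : p.1 ≠ p.2 := ((Finset.mem_filter.1 hp).2).ne
      rw [Finset.sum_sub_distrib, Finset.sum_add_distrib,
        sum_apply_eq p.1 fun u => (ulamDist (x u) z : ℝ),
        sum_apply_eq p.2 fun u => (ulamDist (x u) z : ℝ),
        sum_apply₂_eq hne fun u v => (ulamDist (x u) (x v) : ℝ), hRsum, hGsum]
      ring
    rw [Finset.sum_congr rfl this, Finset.sum_const, card_pairs]
    simp
  have hmedle : ∑ τ : Fin 5 → Ω, (totalDist x (med fun s => x (τ s)) : ℝ) ≤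
      M ^ 5 * R + 20 * (2 * M ^ 5 * R - M ^ 4 * G) := by
    have h1 : ∀ τ : Fin 5 → Ω, (totalDist x (med fun s => x (τ s)) : ℝ) ≤
        R + 2 * M * ∑ p ∈ pairs, ((ulamDist (x (τ p.1)) z : ℝ) +
          ulamDist (x (τ p.2)) z - ulamDist (x (τ p.1)) (x (τ p.2))) := fun τ => by
      have h2 := ulamDist_le_of_sum_le (fun s => x (τ s)) _ z (hmed (fun s => x (τ s)) z)
      have h3 : (totalDist x (med fun s => x (τ s)) : ℝ) ≤
          R + M * ulamDist (med fun s => x (τ s)) z := by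
        rw [ulamDist_comm, hR, hM]; exact_mod_cast totalDist_le x _ z
      have h4 := mul_le_mul_of_nonneg_left h2 hM0
      linarith
    refine (Finset.sum_le_sum fun τ _ => h1 τ).trans (le_of_eq ?_)
    rw [Finset.sum_add_distrib, ← Finset.mul_sum, hdef]
    simp only [Finset.sum_const, Finset.card_univ, Fintype.card_fun, Fintype.card_fin,
      nsmul_eq_mul]
    push_cast
    rw [← hM]
    ring
  have hsing : ∑ τ : Fin 5 → Ω, (totalDist x (x (τ 0)) : ℝ) = M ^ 4 * G :=
    sum_apply_eq 0 fun u => (totalDist x (x u) : ℝ)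
  have hmin : ∀ τ : Fin 5 → Ω,
      min (totalDist x (x (τ 0)) : ℝ) (totalDist x (med fun s => x (τ s))) ≤
      20 / 21 * totalDist x (x (τ 0)) + 1 / 21 * totalDist x (med fun s => x (τ s)) := fun τ => by
    have h1 := min_le_left (totalDist x (x (τ 0)) : ℝ) (totalDist x (med fun s => x (τ s)))
    have h2 := min_le_right (totalDist x (x (τ 0)) : ℝ) (totalDist x (med fun s => x (τ s)))
    linarith
  refine (Finset.sum_le_sum fun τ _ => hmin τ).trans ?_
  rw [Finset.sum_add_distrib, ← Finset.mul_sum, ← Finset.mul_sum, hsing, Fintype.card_fun,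
    Fintype.card_fin]
  push_cast
  rw [← hM]
  linarith

/-- Of `2 K` candidates, two are produced from each group of five samples: the first sample, and
the median of the group. -/
def candidate (med : (Fin 5 → Perm (Fin d)) → Perm (Fin d)) {K : ℕ}
    (x : Fin K → Fin 5 → Perm (Fin d)) (c : Fin K × Bool) : Perm (Fin d) :=
  if c.2 then med (x c.1) else x c.1 0

/-- All candidates are bad with a probability that is exponentially small in the number of groups:
`41 / 21 < 0.99 * 1.99`. -/
theorem card_all_groups_bad_le (x : Ω → Perm (Fin d)) (z : Perm (Fin d))
    {med : (Fin 5 → Perm (Fin d)) → Perm (Fin d)} (hmed : IsMedianFun med) (K : ℕ)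
    [DecidablePred fun γ : Fin K → Fin 5 → Ω => ∀ c,
      1.99 * (totalDist x z : ℝ) < totalDist x (candidate med (fun g s => x (γ g s)) c)] :
    ((Finset.univ.filter fun γ : Fin K → Fin 5 → Ω => ∀ c,
      1.99 * (totalDist x z : ℝ) <
        totalDist x (candidate med (fun g s => x (γ g s)) c)).card : ℝ) ≤
      (99 / 100 : ℝ) ^ K * (Fintype.card (Fin 5 → Ω) : ℝ) ^ K := by
  classical
  set B : Finset (Fin 5 → Ω) := Finset.univ.filter fun τ => 1.99 * (totalDist x z : ℝ) <
    min (totalDist x (x (τ 0)) : ℝ) (totalDist x (med fun s => x (τ s))) with hB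
  have hBcard : (B.card : ℝ) ≤ 99 / 100 * Fintype.card (Fin 5 → Ω) := by
    refine (card_lt_le_of_sum_le (fun τ => by positivity) (by norm_num) (by norm_num)
      (by positivity) (sum_min_totalDist_le x z hmed)).trans ?_
    exact mul_le_mul_of_nonneg_right (by norm_num) (by positivity)
  have hsub : (Finset.univ.filter fun γ : Fin K → Fin 5 → Ω => ∀ c,
      1.99 * (totalDist x z : ℝ) < totalDist x (candidate med (fun g s => x (γ g s)) c)) ⊆
      Fintype.piFinset fun _ => B := by
    intro γ hγ
    rw [Finset.mem_filter] at hγ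
    refine Fintype.mem_piFinset.2 fun g => Finset.mem_filter.2 ⟨Finset.mem_univ _, ?_⟩
    refine lt_min ?_ ?_
    · simpa [candidate] using hγ.2 (g, false)
    · simpa [candidate] using hγ.2 (g, true)
  calc _ ≤ ((Fintype.piFinset fun _ : Fin K => B).card : ℝ) := by
        exact_mod_cast Finset.card_le_card hsub
    _ = (B.card : ℝ) ^ K := by simp
    _ ≤ (99 / 100 * (Fintype.card (Fin 5 → Ω) : ℝ)) ^ K := by gcongr
    _ = _ := mul_pow _ _ _

/-- A candidate that is much worse than the candidate `b` rarely beats it on the test samples. -/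
theorem card_beats_le (x : Ω → Perm (Fin d)) {z y b : Perm (Fin d)}
    (hb : (totalDist x b : ℝ) ≤ 1.99 * totalDist x z)
    (hy : 1.999 * (totalDist x z : ℝ) < totalDist x y) {k : ℕ} (hk : 0 < k)
    [DecidablePred fun T : Fin k → Ω =>
      totalDist (fun j => x (T j)) y ≤ totalDist (fun j => x (T j)) b] :
    ((Finset.univ.filter fun T : Fin k → Ω =>
      totalDist (fun j => x (T j)) y ≤ totalDist (fun j => x (T j)) b).card : ℝ) ≤
      (Fintype.card Ω : ℝ) ^ k * (250000 / k) := by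
  classical
  have hkpos : (0 : ℝ) < k := by exact_mod_cast hk
  have hR : (0 : ℝ) ≤ totalDist x z := by positivity
  have htri : ∀ u v w : Perm (Fin d), (ulamDist u w : ℝ) ≤ ulamDist u v + ulamDist v w :=
    fun u v w => by exact_mod_cast ulamDist_triangle u v w
  have hcast : ∀ v, (totalDist x v : ℝ) = ∑ u, (ulamDist (x u) v : ℝ) := fun v => by
    rw [totalDist]; push_cast; rfl
  have hD : (0 : ℝ) < ulamDist y b := by
    rcases Nat.eq_zero_or_pos (ulamDist y b) with h0 | h0
    · exfalso
      have h1 := totalDist_le x y b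
      rw [ulamDist_comm, h0, mul_zero, add_zero] at h1
      have h1' : (totalDist x y : ℝ) ≤ totalDist x b := by exact_mod_cast h1
      linarith
    · exact_mod_cast h0
  have hDle : (Fintype.card Ω : ℝ) * ulamDist y b ≤ totalDist x y + totalDist x b := by
    have : ∀ u, (ulamDist y b : ℝ) ≤ ulamDist (x u) y + ulamDist (x u) b := fun u => by
      rw [ulamDist_comm (x u) y]; exact htri _ _ _
    have h2 := Finset.sum_le_sum fun u (_ : u ∈ Finset.univ) => this u
    rw [Finset.sum_add_distrib, ← hcast, ← hcast] at h2
    simpa using h2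
  have hmain := card_sum_nonpos_le (fun u => (ulamDist (x u) y : ℝ) - ulamDist (x u) b)
    (D := ulamDist y b) (κ := 1 / 500) (by norm_num) hD (fun u => ?_) ?_ hk
  · refine le_trans (Nat.cast_le.2 (Finset.card_le_card fun T hT => ?_)) (hmain.trans (le_of_eq ?_))
    · rw [Finset.mem_filter] at hT ⊢
      refine ⟨Finset.mem_univ _, ?_⟩
      have h3 := hT.2
      simp only [totalDist] at h3
      have h4 : ∑ j, (ulamDist (x (T j)) y : ℝ) ≤ ∑ j, (ulamDist (x (T j)) b : ℝ) := by
        exact_mod_cast h3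
      rw [Finset.sum_sub_distrib]
      linarith
    · field_simp
      norm_num
  · rw [abs_le]
    have h1 := htri (x u) y b
    have h2 := htri (x u) b y
    rw [ulamDist_comm b y] at h2
    constructor <;> linarith
  · rw [Finset.sum_sub_distrib, ← hcast, ← hcast]
    linarith

/-- The choice of a candidate with the least cost on the test samples rarely fails. -/
theorem card_selection_fails_le (x : Ω → Perm (Fin d)) (z : Perm (Fin d))
    {med : (Fin 5 → Perm (Fin d)) → Perm (Fin d)} (hmed : IsMedianFun med) {K k : ℕ} (hk : 0 < k)
    (out : (Fin K → Fin 5 → Ω) → (Fin k → Ω) → Perm (Fin d))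
    (hout : ∀ γ T, ∃ c, out γ T = candidate med (fun g s => x (γ g s)) c)
    (hmin : ∀ γ T c, totalDist (fun j => x (T j)) (out γ T) ≤
      totalDist (fun j => x (T j)) (candidate med (fun g s => x (γ g s)) c))
    [DecidablePred fun p : (Fin K → Fin 5 → Ω) × (Fin k → Ω) =>
      1.999 * (totalDist x z : ℝ) < totalDist x (out p.1 p.2)] :
    ((Finset.univ.filter fun p : (Fin K → Fin 5 → Ω) × (Fin k → Ω) =>
      1.999 * (totalDist x z : ℝ) < totalDist x (out p.1 p.2)).card : ℝ) ≤
      ((99 / 100 : ℝ) ^ K + 2 * K * (250000 / k)) *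
        Fintype.card ((Fin K → Fin 5 → Ω) × (Fin k → Ω)) := by
  classical
  set cand : (Fin K → Fin 5 → Ω) → Fin K × Bool → Perm (Fin d) := fun γ =>
    candidate med fun g s => x (γ g s) with hcand
  set M : ℝ := ((Fintype.card Ω : ℕ) : ℝ) with hM
  set A := Finset.univ.filter fun γ : Fin K → Fin 5 → Ω => ∀ c,
    1.99 * (totalDist x z : ℝ) < totalDist x (cand γ c) with hA
  have hAle : (A.card : ℝ) ≤ (99 / 100 : ℝ) ^ K * Fintype.card (Fin K → Fin 5 → Ω) := by
    refine (card_all_groups_bad_le x z hmed K).trans (le_of_eq ?_)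
    simp
  have hγ : ∀ γ ∈ Aᶜ, ((Finset.univ.filter fun T : Fin k → Ω =>
      1.999 * (totalDist x z : ℝ) < totalDist x (out γ T)).card : ℝ) ≤
      2 * K * (M ^ k * (250000 / k)) := by
    intro γ hγ
    obtain ⟨b, hb⟩ : ∃ b, (totalDist x (cand γ b) : ℝ) ≤ 1.99 * totalDist x z := by
      by_contra hno
      push Not at hno
      exact Finset.mem_compl.1 hγ (Finset.mem_filter.2 ⟨Finset.mem_univ _, hno⟩)
    set C := Finset.univ.filter fun c : Fin K × Bool =>
      1.999 * (totalDist x z : ℝ) < totalDist x (cand γ c) with hC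
    have hsub : (Finset.univ.filter fun T : Fin k → Ω =>
        1.999 * (totalDist x z : ℝ) < totalDist x (out γ T)) ⊆
        C.biUnion fun c => Finset.univ.filter fun T : Fin k → Ω =>
          totalDist (fun j => x (T j)) (cand γ c) ≤ totalDist (fun j => x (T j)) (cand γ b) := by
      intro T hT
      rw [Finset.mem_filter] at hT
      obtain ⟨c, hc⟩ := hout γ T
      have hc' : out γ T = cand γ c := hc
      refine Finset.mem_biUnion.2 ⟨c, ?_, ?_⟩
      · rw [hC, Finset.mem_filter, ← hc']; exact ⟨Finset.mem_univ _, hT.2⟩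
      · rw [Finset.mem_filter, ← hc']; exact ⟨Finset.mem_univ _, hmin γ T b⟩
    calc _ ≤ ∑ c ∈ C, ((Finset.univ.filter fun T : Fin k → Ω =>
          totalDist (fun j => x (T j)) (cand γ c) ≤
            totalDist (fun j => x (T j)) (cand γ b)).card : ℝ) := by
          exact_mod_cast (Finset.card_le_card hsub).trans Finset.card_biUnion_le
      _ ≤ ∑ _c ∈ C, M ^ k * (250000 / k) := Finset.sum_le_sum fun c hc =>
          card_beats_le x hb (Finset.mem_filter.1 hc).2 hk
      _ ≤ ∑ _c : Fin K × Bool, M ^ k * (250000 / k) :=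
          Finset.sum_le_sum_of_subset_of_nonneg (Finset.subset_univ _) fun _ _ _ => by positivity
      _ = _ := by
          simp only [Finset.sum_const, Finset.card_univ, Fintype.card_prod, Fintype.card_fin,
            Fintype.card_bool, nsmul_eq_mul]
          push_cast
          ring
  have hsplit : ((Finset.univ.filter fun p : (Fin K → Fin 5 → Ω) × (Fin k → Ω) =>
      1.999 * (totalDist x z : ℝ) < totalDist x (out p.1 p.2)).card : ℝ) =
      ∑ γ, ((Finset.univ.filter fun T : Fin k → Ω =>
        1.999 * (totalDist x z : ℝ) < totalDist x (out γ T)).card : ℝ) := by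
    simp only [Finset.card_filter]
    push_cast
    rw [Fintype.sum_prod_type]
    congr!
  rw [hsplit, ← Finset.sum_add_sum_compl A]
  have h1 : ∑ γ ∈ A, ((Finset.univ.filter fun T : Fin k → Ω =>
      1.999 * (totalDist x z : ℝ) < totalDist x (out γ T)).card : ℝ) ≤ A.card * M ^ k := by
    refine (Finset.sum_le_card_nsmul _ _ (M ^ k) fun γ _ => ?_).trans (by rw [nsmul_eq_mul])
    refine le_trans (Nat.cast_le.2 (Finset.card_le_univ _)) ?_
    simp [hM]
  have h2 := (Finset.sum_le_card_nsmul _ _ _ hγ).trans (nsmul_le_nsmul_left (by positivity)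
    (Finset.card_le_univ _))
  rw [nsmul_eq_mul] at h2
  have h3 : (A.card : ℝ) * M ^ k ≤
      (99 / 100 : ℝ) ^ K * Fintype.card (Fin K → Fin 5 → Ω) * M ^ k := by gcongr
  refine (add_le_add (h1.trans h3) h2).trans (le_of_eq ?_)
  rw [Fintype.card_prod, Fintype.card_fun (α := Fin k), Fintype.card_fin]
  push_cast
  rw [← hM]
  ring

end Sampling

end UlamMedian

namespace UlamMedian

open Equiv (Perm)

/-! ### Permutations as numbers -/

variable {d : ℕ}

/-- The number with base-`d` digits `w 0, …, w (d - 1)`, least significant digit first. -/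
def enc (w : Fin d → Fin d) : ℕ := ∑ i, (w i : ℕ) * d ^ (i : ℕ)

theorem enc_eq (w : Fin d → Fin d) : enc w = finFunctionFinEquiv w :=
  (finFunctionFinEquiv_apply w).symm

theorem enc_lt (w : Fin d → Fin d) : enc w < d ^ d := by
  rw [enc_eq]; exact (finFunctionFinEquiv w).2

theorem exists_enc_eq {N : ℕ} (h : N < d ^ d) : ∃ w : Fin d → Fin d, enc w = N :=
  ⟨finFunctionFinEquiv.symm ⟨N, h⟩, by rw [enc_eq, Equiv.apply_symm_apply]⟩

theorem enc_injective : Function.Injective (enc : (Fin d → Fin d) → ℕ) := fun u v h => by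
  rw [enc_eq, enc_eq] at h
  exact finFunctionFinEquiv.injective (Fin.ext h)

theorem digit_enc (w : Fin d → Fin d) (i : Fin d) : enc w / d ^ (i : ℕ) % d = w i := by
  have h := finFunctionFinEquiv_symm_apply_val (finFunctionFinEquiv w) i
  rw [Equiv.symm_apply_apply] at h
  rw [enc_eq]
  exact h.symm

/-- The permutation with the least code among those that satisfy `P`, or among all permutations if
`P` is not satisfiable. -/
noncomputable def leastEnc (P : Perm (Fin d) → Prop) : Perm (Fin d) :=
  Function.argminOn (fun y : Perm (Fin d) => enc y) {y | P y ∨ ¬ ∃ z, P z}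
    (by by_cases h : ∃ z, P z
        · exact h.imp fun _ => Or.inl
        · exact ⟨1, Or.inr h⟩)

theorem leastEnc_spec {P : Perm (Fin d) → Prop} (h : ∃ z, P z) : P (leastEnc P) := by
  have := Function.argminOn_mem (fun y : Perm (Fin d) => enc y) {y | P y ∨ ¬ ∃ z, P z}
    (h.imp fun _ => Or.inl)
  exact this.resolve_right (not_not.2 h)

theorem enc_leastEnc_le {P : Perm (Fin d) → Prop} {y : Perm (Fin d)} (h : P y) :
    enc (leastEnc P) ≤ enc y :=
  Function.argminOn_le (fun y : Perm (Fin d) => enc y) {y | P y ∨ ¬ ∃ z, P z}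
    (show y ∈ {y | P y ∨ ¬ ∃ z, P z} from Or.inl h)

/-- A canonical median of a finite family of permutations. -/
noncomputable def median {Ω : Type*} [Fintype Ω] (x : Ω → Perm (Fin d)) : Perm (Fin d) :=
  leastEnc fun y => ∀ z, totalDist x y ≤ totalDist x z

theorem exists_median {Ω : Type*} [Fintype Ω] (x : Ω → Perm (Fin d)) :
    ∃ y, ∀ z, totalDist x y ≤ totalDist x z :=
  Finite.exists_min (totalDist x)

theorem isMedianFun_median : IsMedianFun (median : (Fin 5 → Perm (Fin d)) → Perm (Fin d)) :=
  fun x => leastEnc_spec (exists_median x)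

/-- The candidate with the least cost on the test samples `t`. -/
noncomputable def selection {K k : ℕ} (x : Fin K → Fin 5 → Perm (Fin d))
    (t : Fin k → Perm (Fin d)) : Perm (Fin d) :=
  leastEnc fun y => (∃ c, y = candidate median x c) ∧
    ∀ c, totalDist t y ≤ totalDist t (candidate median x c)

theorem exists_selection {K k : ℕ} (hK : 0 < K) (x : Fin K → Fin 5 → Perm (Fin d))
    (t : Fin k → Perm (Fin d)) : ∃ y, (∃ c, y = candidate median x c) ∧
      ∀ c, totalDist t y ≤ totalDist t (candidate median x c) := by
  have : Nonempty (Fin K × Bool) := ⟨(⟨0, hK⟩, false)⟩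
  obtain ⟨c, hc⟩ := Finite.exists_min fun c => totalDist t (candidate median x c)
  exact ⟨_, ⟨c, rfl⟩, hc⟩

theorem selection_spec {K k : ℕ} (hK : 0 < K) (x : Fin K → Fin 5 → Perm (Fin d))
    (t : Fin k → Perm (Fin d)) : (∃ c, selection x t = candidate median x c) ∧
      ∀ c, totalDist t (selection x t) ≤ totalDist t (candidate median x c) :=
  leastEnc_spec (exists_selection hK x t)

end UlamMedian

namespace StreamRAM.Term

open UlamMedian
open Equiv (Perm)
open Function (update)

/-! ### Terms for the brute-force computations -/

/-!
In these terms cell `1` holds `d`, cell `2` holds `d ^ d`, and the cells `10, …, 18` are reserved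
for bound variables: `10, …, 15` for those of the Ulam distance, `16, 17, 18` for the searches.
-/

/-- The indicator of `t < u`. -/
def lt (t u : Term) : Term := arith .sub (const 1) (arith .sub (const 1) (arith .sub u t))

/-- The indicator of `t = u`. -/
def eq (t u : Term) : Term :=
  arith .sub (const 1) (arith .add (arith .sub t u) (arith .sub u t))

/-- The product of two terms; on indicators, their conjunction. -/
def mul (t u : Term) : Term := arith .mul t u

/-- The indicator of `u = 0` for all values `< t` of the variable `v`. -/
def none (v : ℕ) (t u : Term) : Term := eq (sum v t u) (const 0)

/-- The sum of a list of terms; on indicators, as a condition, their disjunction. -/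
def sumList : List Term → Term
  | [] => const 0
  | t :: l => arith .add t (sumList l)

/-- Digit number `j` of `a` in the base that cell `1` holds; `a` and `j` are cells. -/
def digit (a j : ℕ) : Term := arith .mod (shift (var a) (var 1) (var j)) (var 1)

/-- The least value `< t` of the variable `v` for which `b ≠ 0`, computed as the number of values of
the auxiliary variable `u` up to which `b = 0` throughout. -/
def least (u v : ℕ) (t b : Term) : Term := sum u t (none v (arith .add (var u) (const 1)) b)

/-- The indicator of distinct digits in cell `a`. -/
def isPerm (a : ℕ) : Term :=
  none 10 (var 1) (sum 11 (var 1) (mul (lt (var 10) (var 11)) (eq (digit a 10) (digit a 11))))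

/-- The indicator of the following property of the words in the cells `a` and `b`: any two symbols
whose positions in `a` carry the digit `0` in the mask `m` occur in the same order in both. -/
def agree (a b m : ℕ) : Term :=
  none 10 (var 1) (sum 11 (var 1) (sum 12 (var 1) (sum 13 (var 1)
    (mul (lt (var 10) (var 11)) (mul (eq (digit a 10) (digit b 12))
      (mul (eq (digit a 11) (digit b 13)) (mul (lt (var 13) (var 12))
        (mul (eq (digit m 10) (const 0)) (eq (digit m 11) (const 0))))))))))

/-- The number of nonzero digits in cell `m`. -/
def weight (m : ℕ) : Term := sum 10 (var 1) (lt (const 0) (digit m 10))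

/-- The Ulam distance of the permutations in the cells `a` and `b`, computed as the number of
`v < d` such that no mask of weight at most `v` makes them agree. -/
def ulam (a b : ℕ) : Term :=
  sum 15 (var 1) (none 14 (var 2) (mul (agree a b 14)
    (lt (weight 14) (arith .add (var 15) (const 1)))))

/-- The sum of the Ulam distances of the permutations in the cells `f j` from that in cell `a`. -/
def cost {k : ℕ} (f : Fin k → ℕ) (a : ℕ) : Term := sumList (List.ofFn fun j => ulam (f j) a)

/-- The canonical median of the permutations in the cells `f j`. -/
def medianTerm {k : ℕ} (f : Fin k → ℕ) : Term :=
  least 17 16 (var 2) (mul (isPerm 16)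
    (none 18 (var 2) (mul (isPerm 18) (lt (cost f 18) (cost f 16)))))

/-- The permutation with the least code among those in the cells `l` for which the cost with
respect to the cells `f j` is least. -/
def selectTerm {k : ℕ} (f : Fin k → ℕ) (l : List ℕ) : Term :=
  least 17 16 (var 2) (mul (sumList (l.map fun a => eq (var 16) (var a)))
    (eq (sumList (l.map fun a => lt (cost f a) (cost f 16))) (const 0)))

/-- A term, read as a condition, holds if its value is not zero. -/
def Holds (t : Term) (ρ : ℕ → ℕ) : Prop := t.eval ρ ≠ 0

section Eval

variable (ρ : ℕ → ℕ) (t u : Term)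

theorem eval_lt : (lt t u).eval ρ = if t.eval ρ < u.eval ρ then 1 else 0 := by
  simp only [lt, eval, Arith.eval]
  split_ifs <;> omega

theorem eval_eq : (eq t u).eval ρ = if t.eval ρ = u.eval ρ then 1 else 0 := by
  simp only [eq, eval, Arith.eval]
  split_ifs <;> omega

theorem eval_mul : (mul t u).eval ρ = t.eval ρ * u.eval ρ := rfl

theorem eval_none (v : ℕ) : (none v t u).eval ρ =
    if ∀ i < t.eval ρ, u.eval (update ρ v i) = 0 then 1 else 0 := by
  simp [none, eval_eq, eval]

theorem eval_sumList (l : List Term) : (sumList l).eval ρ = (l.map fun t => t.eval ρ).sum := by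
  induction l with
  | nil => rfl
  | cons t l ih => simp [sumList, eval, Arith.eval, ih]

theorem eval_digit (a j : ℕ) : (digit a j).eval ρ = ρ a / ρ 1 ^ ρ j % ρ 1 := rfl

theorem holds_lt : (lt t u).Holds ρ ↔ t.eval ρ < u.eval ρ := by
  rw [Holds, eval_lt]; split_ifs <;> simp [*]

theorem holds_eq : (eq t u).Holds ρ ↔ t.eval ρ = u.eval ρ := by
  rw [Holds, eval_eq]; split_ifs <;> simp [*]

theorem holds_mul : (mul t u).Holds ρ ↔ t.Holds ρ ∧ u.Holds ρ := Nat.mul_ne_zero_iff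

theorem holds_none (v : ℕ) : (none v t u).Holds ρ ↔
    ∀ i < t.eval ρ, ¬ u.Holds (update ρ v i) := by
  rw [Holds, eval_none]; simp [Holds]

theorem holds_sum (v : ℕ) : (sum v t u).Holds ρ ↔
    ∃ i < t.eval ρ, u.Holds (update ρ v i) := by
  simp [Holds, eval, Finset.sum_eq_zero_iff]

theorem holds_sumList (l : List Term) : (sumList l).Holds ρ ↔ ∃ t ∈ l, t.Holds ρ := by
  simp [Holds, eval_sumList, List.sum_eq_zero_iff]

end Eval

section Semantics

variable {d : ℕ} {ρ : ℕ → ℕ}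

theorem holds_isPerm (h1 : ρ 1 = d) {a : ℕ} (ha : a < 10 ∨ 15 < a) {w : Fin d → Fin d}
    (hw : ρ a = enc w) : (isPerm a).Holds ρ ↔ Function.Injective w := by
  have h10 : a ≠ 10 := by omega
  have h11 : a ≠ 11 := by omega
  simp only [isPerm, holds_none, holds_sum, holds_mul, holds_lt, holds_eq, eval, eval_digit,
    Function.update_apply, h1, h10, h11, hw, if_true, if_false, Nat.reduceEqDiff]
  constructor
  · intro h i j hij
    by_contra hne
    have key : ∀ i j : Fin d, i < j → w i ≠ w j := fun i j hlt he =>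
      h i i.2 ⟨j, j.2, hlt, by rw [digit_enc, digit_enc, he]⟩
    rcases lt_or_gt_of_ne hne with hlt | hlt
    · exact key i j hlt hij
    · exact key j i hlt hij.symm
  · rintro h i hi ⟨j, hj, hij, he⟩
    have := (digit_enc w ⟨i, hi⟩).symm.trans (he.trans (digit_enc w ⟨j, hj⟩))
    exact hij.ne (congrArg Fin.val (h (Fin.ext this)))

/-- A mask `w` stands for the removal of the symbols at the positions of its nonzero digits. -/
theorem holds_agree (h1 : ρ 1 = d) {a b : ℕ} (ha : a < 10 ∨ 15 < a) (hb : b < 10 ∨ 15 < b)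
    {x y : Perm (Fin d)} {w : Fin d → Fin d} (hx : ρ a = enc x) (hy : ρ b = enc y)
    (hw : ρ 14 = enc w) : (agree a b 14).Holds ρ ↔
      Agree x y (Finset.univ.filter fun s => (w (x.symm s) : ℕ) ≠ 0)ᶜ := by
  have ha0 : a ≠ 10 := by omega
  have ha1 : a ≠ 11 := by omega
  have ha2 : a ≠ 12 := by omega
  have ha3 : a ≠ 13 := by omega
  have hb0 : b ≠ 10 := by omega
  have hb1 : b ≠ 11 := by omega
  have hb2 : b ≠ 12 := by omega
  have hb3 : b ≠ 13 := by omega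
  simp only [agree, holds_none, holds_sum, holds_mul, holds_lt, holds_eq, eval, eval_digit,
    Function.update_apply, h1, ha0, ha1, ha2, ha3, hb0, hb1, hb2, hb3, hx, hy, hw, if_true,
    if_false, Nat.reduceEqDiff]
  constructor
  · intro h s hs t ht hst
    simp only [Finset.mem_compl, Finset.mem_filter, Finset.mem_univ, true_and, ne_eq,
      not_not] at hs ht
    by_contra hlt
    refine h _ (x.symm s).2 ⟨_, (x.symm t).2, _, (y.symm s).2, _, (y.symm t).2, hst, ?_, ?_, ?_,
      ?_, ?_⟩
    · rw [digit_enc, digit_enc]; simp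
    · rw [digit_enc, digit_enc]; simp
    · refine lt_of_le_of_ne (not_lt.1 hlt) fun e => ?_
      rw [y.symm.injective (Fin.ext e)] at hst
      exact lt_irrefl _ hst
    · rw [digit_enc, hs]
    · rw [digit_enc, ht]
  · rintro h i hi ⟨j, hj, p, hp, q, hq, hij, e1, e2, hqp, m1, m2⟩
    have dx := fun (i) (hi : i < d) => digit_enc x ⟨i, hi⟩
    have dy := fun (i) (hi : i < d) => digit_enc y ⟨i, hi⟩
    have dw := fun (i) (hi : i < d) => digit_enc w ⟨i, hi⟩
    simp only at dx dy dw
    rw [dx i hi, dy p hp] at e1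
    rw [dx j hj, dy q hq] at e2
    rw [dw i hi] at m1
    rw [dw j hj] at m2
    have := h (x ⟨i, hi⟩) (by simpa using m1) (x ⟨j, hj⟩) (by simpa using m2)
      (by simpa using hij)
    rw [Fin.ext e1, Fin.ext e2] at this
    simp only [Equiv.symm_apply_apply, Fin.mk_lt_mk] at this
    omega

theorem eval_weight (h1 : ρ 1 = d) {w : Fin d → Fin d} (hw : ρ 14 = enc w)
    (x : Perm (Fin d)) : (weight 14).eval ρ =
      (Finset.univ.filter fun s => (w (x.symm s) : ℕ) ≠ 0).card := by
  simp only [weight, eval, eval_lt, eval_digit, Function.update_apply, h1, hw, if_true, if_false,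
    Nat.reduceEqDiff]
  rw [← Fin.sum_univ_eq_sum_range fun i => if 0 < enc w / d ^ i % d then 1 else 0,
    Finset.card_filter, ← Equiv.sum_comp x fun s => if (w (x.symm s) : ℕ) ≠ 0 then 1 else 0]
  refine Finset.sum_congr rfl fun i _ => ?_
  rw [digit_enc]
  simp [Nat.pos_iff_ne_zero]

theorem eval_ulam (hd : 2 ≤ d) (h1 : ρ 1 = d) (h2 : ρ 2 = d ^ d) {a b : ℕ}
    (ha : a < 10 ∨ 15 < a) (hb : b < 10 ∨ 15 < b) {x y : Perm (Fin d)} (hx : ρ a = enc x)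
    (hy : ρ b = enc y) : (ulam a b).eval ρ = ulamDist x y := by
  have ha4 : a ≠ 14 := by omega
  have hb4 : b ≠ 14 := by omega
  have ha5 : a ≠ 15 := by omega
  have hb5 : b ≠ 15 := by omega
  have key : ∀ v, (none 14 (var 2) (mul (agree a b 14) (lt (weight 14)
      (arith .add (var 15) (const 1))))).eval (update ρ 15 v) =
      if v < ulamDist x y then 1 else 0 := by
    intro v
    have hw : ∀ w : Fin d → Fin d, (mul (agree a b 14) (lt (weight 14)
        (arith .add (var 15) (const 1)))).Holds (update (update ρ 15 v) 14 (enc w)) ↔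
        Agree x y (Finset.univ.filter fun s => (w (x.symm s) : ℕ) ≠ 0)ᶜ ∧
        (Finset.univ.filter fun s => (w (x.symm s) : ℕ) ≠ 0).card ≤ v := fun w => by
      rw [holds_mul, holds_lt, holds_agree (w := w) (x := x) (y := y) (by simpa) ha hb
        (by simpa [ha4, ha5]) (by simpa [hb4, hb5]) (by simp),
        eval_weight (w := w) (by simpa) (by simp) x]
      simp [eval, Arith.eval]
    rw [eval_none]
    refine if_congr ?_ rfl rfl
    rw [← not_le, ulamDist_le_iff, not_exists]
    simp only [eval, Function.update_apply, Nat.reduceEqDiff, if_false, h2]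
    -- masks with digits `0` and `1` represent all sets of symbols, as `2 ≤ d`
    constructor
    · rintro h T ⟨hT, hc⟩
      set w : Fin d → Fin d := fun i => if x i ∈ T then ⟨1, by omega⟩ else ⟨0, by omega⟩ with hwdef
      have hset : (Finset.univ.filter fun s => (w (x.symm s) : ℕ) ≠ 0) = T := by
        ext s
        by_cases hs : s ∈ T <;> simp [hwdef, hs]
      have := (hw w).2 (by rw [hset]; exact ⟨hT, hc⟩)
      exact this (h _ (enc_lt w))
    · intro h N hN
      obtain ⟨w, rfl⟩ := exists_enc_eq hN
      by_contra hne
      exact h _ ((hw w).1 hne)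
  rw [ulam, eval, Finset.sum_congr rfl fun v _ => key v, ← Finset.sum_filter]
  simp only [eval, h1, Finset.sum_const, smul_eq_mul, mul_one]
  rw [show (Finset.range d).filter (fun v => v < ulamDist x y) = Finset.range (ulamDist x y) from
    ?_, Finset.card_range]
  ext v
  have := ulamDist_le_self x y
  simp only [Finset.mem_filter, Finset.mem_range]
  omega

theorem eval_cost (hd : 2 ≤ d) (h1 : ρ 1 = d) (h2 : ρ 2 = d ^ d) {k : ℕ} {f : Fin k → ℕ} {a : ℕ}
    (hf : ∀ j, 20 ≤ f j) (ha : a < 10 ∨ 15 < a) {x : Fin k → Perm (Fin d)} {y : Perm (Fin d)}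
    (hx : ∀ j, ρ (f j) = enc (x j)) (hy : ρ a = enc y) :
    (cost f a).eval ρ = totalDist x y := by
  rw [cost, eval_sumList, List.map_ofFn, List.sum_ofFn, totalDist]
  exact Finset.sum_congr rfl fun j _ =>
    eval_ulam hd h1 h2 (Or.inr (by have := hf j; omega)) ha (hx j) hy

/-- The minimization operator finds the permutation with the least code that satisfies `P`. -/
theorem eval_least {b : Term} {P : Perm (Fin d) → Prop} (hP : ∃ z, P z) (h2 : ρ 2 = d ^ d)
    (hb : ∀ (i : ℕ) (w : Fin d → Fin d), b.Holds (update (update ρ 17 i) 16 (enc w)) ↔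
      ∃ y : Perm (Fin d), (y : Fin d → Fin d) = w ∧ P y) :
    (least 17 16 (var 2) b).eval ρ = enc (leastEnc P) := by
  have key : ∀ i < d ^ d, (none 16 (arith .add (var 17) (const 1)) b).eval (update ρ 17 i) =
      if i < enc (leastEnc P) then 1 else 0 := by
    intro i hi
    rw [eval_none]
    refine if_congr ?_ rfl rfl
    simp only [eval, Arith.eval, Function.update_self]
    constructor
    · intro h
      by_contra hlt
      exact (hb i _).2 ⟨_, rfl, leastEnc_spec hP⟩ (h _ (by omega))
    · intro h N hN
      obtain ⟨w, rfl⟩ := exists_enc_eq (show N < d ^ d by omega)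
      by_contra hne
      obtain ⟨y, rfl, hy⟩ := (hb i w).1 hne
      have := enc_leastEnc_le hy
      omega
  have hlt := enc_lt (leastEnc P)
  rw [least, eval]
  simp only [eval, h2]
  rw [Finset.sum_congr rfl fun v hv => key v (Finset.mem_range.1 hv), ← Finset.sum_filter]
  simp only [Finset.sum_const, smul_eq_mul, mul_one]
  rw [show (Finset.range (d ^ d)).filter (fun v => v < enc (leastEnc P)) =
    Finset.range (enc (leastEnc P)) from ?_, Finset.card_range]
  ext v
  simp only [Finset.mem_filter, Finset.mem_range]
  omega

theorem exists_perm_iff {w : Fin d → Fin d} {P : Perm (Fin d) → Prop} :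
    (∃ y : Perm (Fin d), (y : Fin d → Fin d) = w ∧ P y) ↔
      ∃ h : Function.Injective w, P (Equiv.ofBijective w (Finite.injective_iff_bijective.1 h)) := by
  constructor
  · rintro ⟨y, rfl, hy⟩
    refine ⟨y.injective, ?_⟩
    convert hy
    ext i
    simp
  · rintro ⟨h, hP⟩
    exact ⟨_, rfl, hP⟩

theorem eval_medianTerm (hd : 2 ≤ d) (h1 : ρ 1 = d) (h2 : ρ 2 = d ^ d) {k : ℕ} {f : Fin k → ℕ}
    (hf : ∀ j, 20 ≤ f j) {x : Fin k → Perm (Fin d)} (hx : ∀ j, ρ (f j) = enc (x j)) :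
    (medianTerm f).eval ρ = enc (median x) := by
  refine eval_least (exists_median x) h2 fun i w => ?_
  have hf6 : ∀ j, f j ≠ 16 := fun j => by have := hf j; omega
  have hf7 : ∀ j, f j ≠ 17 := fun j => by have := hf j; omega
  have hf8 : ∀ j, f j ≠ 18 := fun j => by have := hf j; omega
  rw [exists_perm_iff, holds_mul, holds_isPerm (w := w) (by simpa) (by simp) (by simp),
    ← exists_prop]
  refine exists_congr fun hw => ?_
  set y : Perm (Fin d) := Equiv.ofBijective w (Finite.injective_iff_bijective.1 hw) with hy
  rw [holds_none]
  simp only [eval, Function.update_apply, Nat.reduceEqDiff, if_false, h2]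
  have hN : ∀ v : Fin d → Fin d, (mul (isPerm 18) (lt (cost f 18) (cost f 16))).Holds
      (update (update (update ρ 17 i) 16 (enc w)) 18 (enc v)) ↔
      ∃ z : Perm (Fin d), (z : Fin d → Fin d) = v ∧ totalDist x z < totalDist x y := by
    intro v
    rw [exists_perm_iff, holds_mul, holds_isPerm (w := v) (by simpa) (by simp) (by simp),
      ← exists_prop]
    refine exists_congr fun hv => ?_
    rw [holds_lt,
      eval_cost (x := x) (y := Equiv.ofBijective v (Finite.injective_iff_bijective.1 hv)) hd
        (by simpa) (by simpa) hf (by simp) (fun j => by simpa [hf6, hf7, hf8] using hx j) (by simp),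
      eval_cost (x := x) (y := y) hd (by simpa) (by simpa) hf
        (by simp) (fun j => by simpa [hf6, hf7, hf8] using hx j) (by simp [hy])]
  constructor
  · intro h z
    by_contra hlt
    exact h _ (enc_lt z) ((hN z).2 ⟨z, rfl, not_le.1 hlt⟩)
  · intro h N hN' hc
    obtain ⟨v, rfl⟩ := exists_enc_eq hN'
    obtain ⟨z, _, hz⟩ := (hN v).1 hc
    exact absurd (h z) (not_le.2 hz)

theorem eval_selectTerm (hd : 2 ≤ d) (h1 : ρ 1 = d) (h2 : ρ 2 = d ^ d) {k K : ℕ} (hK : 0 < K)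
    {f : Fin k → ℕ} (hf : ∀ j, 20 ≤ f j) {t : Fin k → Perm (Fin d)}
    (ht : ∀ j, ρ (f j) = enc (t j)) {x : Fin K → Fin 5 → Perm (Fin d)} {l : List ℕ}
    (hl : ∀ a ∈ l, 20 ≤ a ∧ ∃ c, ρ a = enc (candidate median x c))
    (hl' : ∀ c, ∃ a ∈ l, ρ a = enc (candidate median x c)) :
    (selectTerm f l).eval ρ = enc (selection x t) := by
  refine eval_least (exists_selection hK x t) h2 fun i w => ?_
  have hf6 : ∀ j, f j ≠ 16 := fun j => by have := hf j; omega
  have hf7 : ∀ j, f j ≠ 17 := fun j => by have := hf j; omega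
  set σ := update (update ρ 17 i) 16 (enc w) with hσ
  have hσl : ∀ a, 20 ≤ a → σ a = ρ a := fun a ha => by
    simp [hσ, show a ≠ 16 by omega, show a ≠ 17 by omega]
  have hcand : (sumList (l.map fun a => eq (var 16) (var a))).Holds σ ↔
      ∃ c, w = (candidate median x c : Fin d → Fin d) := by
    rw [holds_sumList]
    simp only [List.mem_map, exists_exists_and_eq_and, holds_eq, eval]
    have h16 : σ 16 = enc w := by simp [hσ]
    constructor
    · rintro ⟨a, ha, e⟩
      obtain ⟨h20, c, hc⟩ := hl a ha
      exact ⟨c, enc_injective (by rw [← hc, ← hσl a h20, ← e, h16])⟩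
    · rintro ⟨c, rfl⟩
      obtain ⟨a, ha, hc⟩ := hl' c
      exact ⟨a, ha, by rw [h16, hσl a (hl a ha).1, hc]⟩
  have hcost : ∀ (a : ℕ) (y : Perm (Fin d)), (a < 10 ∨ 15 < a) → σ a = enc y →
      (cost f a).eval σ = totalDist t y := fun a y ha hy =>
    eval_cost hd (by simpa [hσ]) (by simpa [hσ]) hf ha
      (fun j => by rw [hσl _ (hf j)]; exact ht j) hy
  rw [holds_mul, hcand]
  have hmin : ∀ y : Perm (Fin d), (y : Fin d → Fin d) = w →
      ((eq (sumList (l.map fun a => lt (cost f a) (cost f 16))) (const 0)).Holds σ ↔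
        ∀ c, totalDist t y ≤ totalDist t (candidate median x c)) := by
    rintro y rfl
    have h0 : (eq (sumList (l.map fun a => lt (cost f a) (cost f 16))) (const 0)).Holds σ ↔
        ¬ (sumList (l.map fun a => lt (cost f a) (cost f 16))).Holds σ := by
      rw [holds_eq, Holds, not_not]; rfl
    rw [h0, holds_sumList]
    simp only [List.mem_map, exists_exists_and_eq_and, holds_lt, not_exists, not_and, not_lt]
    have hy := hcost 16 y (by simp) (by simp [hσ])
    constructor
    · intro h c
      obtain ⟨a, ha, hc⟩ := hl' c
      have := h a ha
      rwa [hy, hcost a _ (Or.inr (by have := (hl a ha).1; omega))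
        (by rw [hσl a (hl a ha).1, hc])] at this
    · intro h a ha
      obtain ⟨h20, c, hc⟩ := hl a ha
      rw [hy, hcost a _ (Or.inr (by omega)) (by rw [hσl a h20, hc])]
      exact h c
  constructor
  · rintro ⟨⟨c, hc⟩, h⟩
    exact ⟨candidate median x c, hc.symm, ⟨c, rfl⟩, (hmin _ hc.symm).1 h⟩
  · rintro ⟨y, hy, ⟨c, hc⟩, h⟩
    exact ⟨⟨c, by rw [← hy, hc]⟩, (hmin y hy).2 h⟩

end Semantics

end StreamRAM.Term

namespace StreamRAM

open UlamMedian
open Equiv (Perm)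

/-! ### Programs over named cells -/

/-- An abstract configuration: only the contents of the named cells matter. -/
structure State where
  mem : ℕ → ℕ
  input : List ℕ
  output : List ℕ
  flips : ℕ

/-- `M[a] := v` -/
def State.set (σ : State) (a v : ℕ) : State := { σ with mem := Function.update σ.mem a v }

@[simp] theorem State.set_mem (σ : State) (a v b : ℕ) :
    (σ.set a v).mem b = if b = a then v else σ.mem b := by
  simp [State.set, Function.update_apply]

@[simp] theorem State.set_input (σ : State) (a v : ℕ) : (σ.set a v).input = σ.input := rfl
@[simp] theorem State.set_output (σ : State) (a v : ℕ) : (σ.set a v).output = σ.output := rfl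
@[simp] theorem State.set_flips (σ : State) (a v : ℕ) : (σ.set a v).flips = σ.flips := rfl

/-- An exponent in a polynomial bound for the values of the term. -/
noncomputable def Term.degree (t : Term) : ℕ := t.exists_fits.choose

/-- The resources of a program: the cells below `top` are the named ones, and they hold numbers up
to `B`; the cells from `top` up to `A` are scratch cells; all cells hold numbers up to `B ^ E`. -/
structure Frame where
  top : ℕ
  A : ℕ
  B : ℕ
  E : ℕ
  coins : ℕ → Bool
  two_le_B : 2 ≤ B
  one_le_E : 1 ≤ E
  top_lt : top < A

namespace Frame

variable (F : Frame)

theorem B_le : F.B ≤ F.B ^ F.E := Nat.le_self_pow (by have := F.one_le_E; omega) _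

/-- The configuration `s` is described by the abstract configuration `σ`. -/
def Rep (s : Config) (σ : State) : Prop :=
  s.Bdd F.A (F.B ^ F.E) ∧ (∀ a < F.top, s.mem a = σ.mem a ∧ σ.mem a ≤ F.B) ∧
    s.input = σ.input ∧ s.output = σ.output ∧ s.flips = σ.flips

/-- Weakest precondition in terms of abstract configurations. -/
def Runs (p : Prog) (Q : State → Prop) (σ : State) : Prop :=
  ∀ s, F.Rep s σ → WP F.A (F.B ^ F.E) F.coins p (fun t => ∃ τ, F.Rep t τ ∧ Q τ) s

/-- The term can be evaluated with the resources of the frame. -/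
def Adm (t : Term) : Prop := t.Below F.top ∧ F.top + t.width ≤ F.A ∧ t.degree ≤ F.E

variable {F} {Q : State → Prop} {σ : State}

theorem Rep.set {s : Config} (h : F.Rep s σ) {a v : ℕ} (ha : a < F.top) (hv : v ≤ F.B) :
    F.Rep (s.set a v) (σ.set a v) := by
  refine ⟨h.1.set (ha.trans F.top_lt) (hv.trans F.B_le), fun b hb => ?_, h.2.2.1, h.2.2.2.1,
    h.2.2.2.2⟩
  rw [Config.set_mem, State.set_mem]
  split_ifs
  · exact ⟨rfl, hv⟩
  · exact h.2.1 b hb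

theorem runs_seq {p q : Prog} (h : F.Runs p (fun τ => F.Runs q Q τ) σ) : F.Runs (.seq p q) Q σ :=
  fun s hs => wp_seq ((h s hs).mono fun t _ ⟨_, ht, hq⟩ _ => hq t ht)

theorem Runs.mono {p : Prog} {R : State → Prop} (h : F.Runs p R σ) (hR : ∀ τ, R τ → Q τ) :
    F.Runs p Q σ :=
  fun s hs => (h s hs).mono fun _ _ ⟨_, ht, hr⟩ => ⟨_, ht, hR _ hr⟩

theorem runs_const {a v : ℕ} (ha : a < F.top) (hv : v ≤ F.B) (hQ : Q (σ.set a v)) :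
    F.Runs (.instr (.const a v)) Q σ :=
  fun _ hs => wp_instr hs.1 (hs.set ha hv).1 ⟨_, hs.set ha hv, hQ⟩

theorem runs_read {a : ℕ} (ha : a < F.top) (hv : σ.input.headD 0 ≤ F.B)
    (hQ : Q { σ.set a (σ.input.headD 0) with input := σ.input.tail }) :
    F.Runs (.instr (.read a)) Q σ := by
  intro s hs
  have h := hs.set ha hv
  have hin := hs.2.2.1
  refine wp_instr hs.1 ?_ ⟨{ σ.set a (σ.input.headD 0) with input := σ.input.tail },
    ⟨?_, fun b hb => ?_, ?_, h.2.2.2.1, h.2.2.2.2⟩, hQ⟩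
  · simp only [Instr.step, hin]; exact h.1
  · simp only [Instr.step, hin]; exact h.1
  · simp only [Instr.step, hin]; exact h.2.1 b hb
  · simp only [Instr.step, hin]

theorem runs_flip {a : ℕ} (ha : a < F.top)
    (hQ : Q { σ.set a (F.coins σ.flips).toNat with flips := σ.flips + 1 }) :
    F.Runs (.instr (.flip a)) Q σ := by
  intro s hs
  have hfl := hs.2.2.2.2
  have hv : (F.coins σ.flips).toNat ≤ F.B :=
    (Bool.toNat_le _).trans (by have := F.two_le_B; omega)
  have h := hs.set ha hv
  refine wp_instr hs.1 ?_ ⟨{ σ.set a (F.coins σ.flips).toNat with flips := σ.flips + 1 },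
    ⟨?_, fun b hb => ?_, h.2.2.1, h.2.2.2.1, ?_⟩, hQ⟩
  · simp only [Instr.step, hfl]; exact h.1
  · simp only [Instr.step, hfl]; exact h.1
  · simp only [Instr.step, hfl]; exact h.2.1 b hb
  · simp only [Instr.step, hfl]

theorem runs_write {a : ℕ} (ha : a < F.top)
    (hQ : Q { σ with output := σ.output ++ [σ.mem a] }) : F.Runs (.instr (.write a)) Q σ := by
  intro s hs
  refine wp_write hs.1 ⟨{ σ with output := σ.output ++ [σ.mem a] },
    ⟨hs.1, hs.2.1, hs.2.2.1, ?_, hs.2.2.2.2⟩, hQ⟩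
  simp only [hs.2.2.2.1, (hs.2.1 a ha).1]

end Frame

/-- `M[v] := t`, with scratch cells from `top` on. -/
def assign (top v : ℕ) (t : Term) : Prog := .seq (t.compile top) (copyProg v top)

/-- Repeat the program `p` as often as the value of `t` says, counting down in the cell `c`. -/
def repeatProg (top c : ℕ) (t : Term) (p : Prog) : Prog :=
  .seq (assign top c t)
    (.loop c (.seq p (assign top c (.arith .sub (.var c) (.const 1)))))

/-- The programs `f 0, …, f (m - 1)` one after another; cell `19` is only used for a dummy
instruction at the beginning. -/
def seqAll (f : ℕ → Prog) : ℕ → Prog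
  | 0 => .instr (.const 19 0)
  | m + 1 => .seq (seqAll f m) (f m)

namespace Frame

variable {F : Frame} {Q : State → Prop} {σ : State}

theorem runs_assign {v : ℕ} {t : Term} (ht : F.Adm t) (hv : v < F.top)
    (hle : t.eval σ.mem ≤ F.B) (hQ : Q (σ.set v (t.eval σ.mem))) :
    F.Runs (assign F.top v t) Q σ := by
  intro s hs
  -- cells from `top` on are irrelevant for the term; zeros there keep all variables below `B`
  set ρ : ℕ → ℕ := fun a => if a < F.top then s.mem a else 0 with hρ
  have hρB : ∀ a, ρ a ≤ F.B := fun a => by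
    simp only [hρ]
    split_ifs with h
    · rw [(hs.2.1 a h).1]; exact (hs.2.1 a h).2
    · exact Nat.zero_le _
  have hρs : ∀ a < F.top, ρ a = s.mem a := fun a ha => by simp [hρ, ha]
  have hfit := (t.exists_fits.choose_spec F.B F.two_le_B ρ hρB (F.B ^ F.E)
    (Nat.pow_le_pow_right (by have := F.two_le_B; omega) ht.2.2)).1.congr ht.1 hρs
  have hev : t.eval s.mem = t.eval σ.mem := Term.eval_congr ht.1 fun a ha => (hs.2.1 a ha).1
  refine wp_seq (Term.wp_compile (Nat.one_le_pow _ _ (by have := F.two_le_B; omega)) t F.top s _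
    ht.1 ht.2.1 hs.1 hfit fun s1 h1 h1k io1 b1 => ?_)
  refine (wp_copy b1 hv.ne (hv.trans F.top_lt) fun s2 h2 io2 => ?_ :
    WP _ _ _ _ (fun t' => (∀ c, t'.mem c = if c = v then s1.mem F.top else s1.mem c) ∧
      s1.SameTapes t') _).mono fun s2 b2 h2 => ?_
  · exact ⟨h2, io2⟩
  · have io := io1.trans h2.2
    refine ⟨σ.set v (t.eval σ.mem), ⟨b2, fun a ha => ?_, io.1.trans hs.2.2.1,
      io.2.1.trans hs.2.2.2.1, io.2.2.trans hs.2.2.2.2⟩, hQ⟩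
    rw [h2.1, State.set_mem, h1k, hev]
    split_ifs
    · exact ⟨rfl, hle⟩
    · rw [h1 a ha]; exact hs.2.1 a ha

/-- Rule for `repeatProg`: `I i` holds after `i` rounds, whatever the counter contains. -/
theorem runs_repeat {c : ℕ} {t : Term} {p : Prog} (I : ℕ → State → Prop) {N : ℕ}
    (ht : F.Adm t) (hdec : F.Adm (.arith .sub (.var c) (.const 1))) (hc : c < F.top)
    (hN : t.eval σ.mem = N) (hNB : N ≤ F.B)
    (hI : ∀ i τ v, I i τ → I i (τ.set c v)) (h0 : I 0 σ)
    (hstep : ∀ i < N, ∀ τ, I i τ → F.Runs p (fun υ => υ.mem c = τ.mem c ∧ I (i + 1) υ) τ)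
    (hdone : ∀ τ, I N τ → Q τ) : F.Runs (repeatProg F.top c t p) Q σ := by
  refine runs_seq (runs_assign ht hc (hN ▸ hNB) ?_)
  rw [hN]
  intro s hs
  refine wp_loop (fun j s => ∃ τ, F.Rep s τ ∧ τ.mem c = j ∧ ∃ i, i + j = N ∧ I i τ) ?_ ?_ N s hs.1
    ⟨_, hs, by simp, 0, by omega, hI _ _ _ h0⟩
  · rintro j s _ ⟨τ, hs, hcj, i, hij, hi⟩
    refine ⟨by rw [(hs.2.1 c hc).1]; omega, ?_⟩
    refine runs_seq (Q := fun τ => τ.mem c = j ∧ ∃ i, i + j = N ∧ I i τ)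
      ((hstep i (by omega) τ hi).mono fun υ hυ => ?_) s hs
    have e : (Term.arith .sub (.var c) (.const 1)).eval υ.mem = j := by
      simp [Term.eval, Arith.eval, hυ.1, hcj]
    refine runs_assign hdec hc (by omega) ⟨by simp [e], i + 1, by omega, hI _ _ _ hυ.2⟩
  · clear hs
    rintro s _ ⟨τ, hs, hcj, i, hij, hi⟩
    obtain rfl : i = N := by omega
    exact ⟨by rw [(hs.2.1 c hc).1, hcj], τ, hs, hdone τ hi⟩

theorem runs_seqAll {f : ℕ → Prog} (J : ℕ → State → Prop) (m : ℕ) (h19 : 19 < F.top)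
    (h0 : J 0 (σ.set 19 0)) (hstep : ∀ i < m, ∀ τ, J i τ → F.Runs (f i) (J (i + 1)) τ) :
    F.Runs (seqAll f m) (J m) σ := by
  induction m with
  | zero => exact runs_const h19 (Nat.zero_le _) h0
  | succ m ih =>
    exact runs_seq ((ih fun i hi => hstep i (by omega)).mono fun τ hτ => hstep m (by omega) τ hτ)

end Frame

end StreamRAM

namespace StreamRAM

open UlamMedian
open Equiv (Perm)
open Term (var const arith mul eq)

/-! ### The streaming program -/

/-- The number whose binary digits are the `L` coins after the first `off` ones. -/
def coinNumber (ω : ℕ → Bool) (off : ℕ) : ℕ → ℕ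
  | 0 => 0
  | L + 1 => 2 * coinNumber ω off L + (ω (off + L)).toNat

/-- The `s`-th sampled index, drawn with `n + 20` coins. -/
def sampleIndex (ω : ℕ → Bool) (n s : ℕ) : ℕ := coinNumber ω (s * (n + 20)) (n + 20) % n

section Cells

variable (K m : ℕ)

/-- The cell with the code of the `s`-th sampled permutation. The cells from `20` on hold the
sampled indices. -/
def sampleCell (s : ℕ) : ℕ := 20 + (5 * K + m) + s

/-- The cell with the median of the `g`-th group. -/
def medianCell (g : ℕ) : ℕ := 20 + 2 * (5 * K + m) + g

/-- The first scratch cell. -/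
def topCell : ℕ := 20 + 2 * (5 * K + m) + K

/-- The cells with the candidates. -/
def candidateCells : List ℕ :=
  (List.ofFn fun g : Fin K => sampleCell K m (5 * g)) ++ List.ofFn fun g : Fin K => medianCell K m g

/-- Append the coin in cell `8` to the binary expansion of the `s`-th index, modulo `n`. -/
def flipTerm (s : ℕ) : Term :=
  arith .mod (arith .add (mul (const 2) (var (20 + s))) (var 8)) (var 0)

/-- Add the symbol just read, in cell `7` and shifted to start from `0`, times the current power of
`d` to the code of the `s`-th sample if the latter has the index of the current permutation. -/
def storeTerm (s : ℕ) : Term :=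
  arith .add (var (sampleCell K m s))
    (mul (eq (var (20 + s)) (var 5)) (mul (arith .sub (var 7) (const 1)) (var 6)))

/-- The median of the `g`-th group. -/
def groupMedianTerm (g : ℕ) : Term :=
  Term.medianTerm fun j : Fin 5 => sampleCell K m (5 * g + j)

/-- The best candidate on the test samples, which follow the samples of the groups. -/
def selectionTerm : Term :=
  Term.selectTerm (fun j : Fin m => sampleCell K m (5 * K + j)) (candidateCells K m)

/-- All terms that the program evaluates. -/
def programTerms : List Term :=
  [var 0, var 1, mul (var 2) (var 1), arith .add (var 0) (const 20), mul (var 6) (var 1),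
    arith .add (var 5) (const 1), arith .sub (var 3) (const 1), arith .sub (var 4) (const 1),
    arith .add (arith .mod (var 9) (var 1)) (const 1), arith .div (var 9) (var 1),
    selectionTerm K m] ++ (List.range (5 * K + m)).map flipTerm ++
    (List.range (5 * K + m)).map (storeTerm K m) ++ (List.range K).map (groupMedianTerm K m)

/-- Compute `d ^ d` in cell `2`. -/
def powerProg : Prog :=
  .seq (.instr (.const 2 1)) (repeatProg (topCell K m) 3 (var 1)
    (assign (topCell K m) 2 (mul (var 2) (var 1))))

/-- Draw the `s`-th index. -/
def drawProg (s : ℕ) : Prog :=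
  repeatProg (topCell K m) 3 (arith .add (var 0) (const 20))
    (.seq (.instr (.flip 8)) (assign (topCell K m) (20 + s) (flipTerm s)))

/-- Read one symbol into cell `7` and add it to the codes of those samples that have the index of
the current permutation, held by cell `5`; cell `6` holds the current power of `d`. -/
def symbolProg : Prog :=
  .seq (.instr (.read 7))
    (.seq (seqAll (fun s => assign (topCell K m) (sampleCell K m s) (storeTerm K m s)) (5 * K + m))
      (assign (topCell K m) 6 (mul (var 6) (var 1))))

/-- Read one permutation. -/
def permProg : Prog :=
  .seq (.instr (.const 6 1)) (.seq (repeatProg (topCell K m) 4 (var 1) (symbolProg K m))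
    (assign (topCell K m) 5 (arith .add (var 5) (const 1))))

/-- Read the stream. -/
def readProg : Prog :=
  .seq (.instr (.const 5 0)) (repeatProg (topCell K m) 3 (var 0) (permProg K m))

/-- Write the permutation in cell `9`. -/
def writeProg : Prog :=
  repeatProg (topCell K m) 3 (var 1)
    (.seq (assign (topCell K m) 7 (arith .add (arith .mod (var 9) (var 1)) (const 1)))
      (.seq (.instr (.write 7)) (assign (topCell K m) 9 (arith .div (var 9) (var 1)))))

/-- The algorithm: draw indices of `K` groups of five samples and of `m` test samples, store the
permutations with these indices, compute the medians of the groups, and select the candidate that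
is best on the test samples. -/
def program : Prog :=
  .seq (powerProg K m) (.seq (seqAll (drawProg K m) (5 * K + m)) (.seq (readProg K m)
    (.seq (seqAll (fun g => assign (topCell K m) (medianCell K m g) (groupMedianTerm K m g)) K)
      (.seq (assign (topCell K m) 9 (selectionTerm K m)) (writeProg K m)))))

end Cells

/-! ### Correctness of the program -/

/-- Digit number `l` of the permutation, `0` if `l` is out of range. -/
def digitAt {d : ℕ} (y : Perm (Fin d)) (l : ℕ) : ℕ := if h : l < d then y ⟨l, h⟩ else 0

/-- The code of the first `j` symbols of the permutation. -/
def partialEnc {d : ℕ} (y : Perm (Fin d)) (j : ℕ) : ℕ :=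
  ∑ l ∈ Finset.range j, digitAt y l * d ^ l

theorem partialEnc_self {d : ℕ} (y : Perm (Fin d)) : partialEnc y d = enc y := by
  rw [partialEnc, ← Fin.sum_univ_eq_sum_range fun l => digitAt y l * d ^ l]
  simp [enc, digitAt]

theorem partialEnc_lt {d : ℕ} (y : Perm (Fin d)) {j : ℕ} (hj : j ≤ d) :
    partialEnc y j < d ^ d := by
  refine lt_of_le_of_lt ?_ (enc_lt y)
  rw [← partialEnc_self]
  exact Finset.sum_le_sum_of_subset (Finset.range_mono hj)

theorem permWord_getElem {d : ℕ} (y : Perm (Fin d)) {j : ℕ} (hj : j < (permWord y).length) :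
    (permWord y)[j] = digitAt y j + 1 := by
  have hj' : j < d := by simpa [permWord] using hj
  simp [permWord, digitAt, hj']

/-- The cells `0`, `1`, `2` hold the parameters, and nothing has been written. -/
def Base (n d : ℕ) (σ : State) : Prop :=
  σ.mem 0 = n ∧ σ.mem 1 = d ∧ σ.mem 2 = d ^ d ∧ σ.output = []

theorem Base.set {n d : ℕ} {σ : State} (h : Base n d σ) {a : ℕ} (ha : 2 < a) (v : ℕ) :
    Base n d (σ.set a v) := by
  refine ⟨?_, ?_, ?_, h.2.2.2⟩
  · rw [State.set_mem, if_neg (by omega), h.1]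
  · rw [State.set_mem, if_neg (by omega), h.2.1]
  · rw [State.set_mem, if_neg (by omega), h.2.2.1]

section Correctness

variable {K m n d : ℕ} {F : Frame} {σ : State}

theorem runs_powerProg (hF : F.top = topCell K m) (hA : ∀ t ∈ programTerms K m, F.Adm t)
    (hB : F.B = n + 20 + d ^ d) (hd : 2 ≤ d) {inp : List ℕ}
    (hσ : σ.mem 0 = n ∧ σ.mem 1 = d ∧ (∀ a, 20 ≤ a → σ.mem a = 0) ∧ σ.input = inp ∧
      σ.output = [] ∧ σ.flips = 0) :
    F.Runs (powerProg K m) (fun τ => Base n d τ ∧ (∀ a, 20 ≤ a → τ.mem a = 0) ∧ τ.input = inp ∧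
      τ.flips = 0) σ := by
  have htop : 20 ≤ F.top := by rw [hF, topCell]; omega
  have hdd : d ≤ d ^ d := Nat.le_self_pow (by omega) _
  have hdB : d ≤ F.B := by omega
  rw [powerProg, ← hF]
  refine Frame.runs_seq (Frame.runs_const (by omega) (by omega) ?_)
  refine Frame.runs_repeat (N := d) (fun i τ => τ.mem 0 = n ∧ τ.mem 1 = d ∧ τ.mem 2 = d ^ i ∧
    (∀ a, 20 ≤ a → τ.mem a = 0) ∧ τ.input = inp ∧ τ.output = [] ∧ τ.flips = 0)
    (hA _ (by simp [programTerms])) (hA _ (by simp [programTerms])) (by omega) ?_ hdB ?_ ?_ ?_ ?_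
  · simp [Term.eval, hσ.2.1]
  · rintro i τ v ⟨h0, h1, h2, h3, h4⟩
    exact ⟨by simpa, by simpa, by simpa,
      fun a ha => by rw [State.set_mem, if_neg (by omega), h3 a ha], h4⟩
  · exact ⟨by simp [hσ.1], by simp [hσ.2.1], by simp,
      fun a ha => by rw [State.set_mem, if_neg (by omega), hσ.2.2.1 a ha], hσ.2.2.2⟩
  · rintro i hi τ ⟨h0, h1, h2, h3, h4⟩
    have e : (mul (var 2) (var 1)).eval τ.mem = d ^ (i + 1) := by
      rw [Term.eval_mul]; simp [Term.eval, h1, h2, pow_succ]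
    refine Frame.runs_assign (hA _ (by simp [programTerms])) (by omega) ?_ ?_
    · rw [e, hB]
      have := Nat.pow_le_pow_right (show 0 < d by omega) (show i + 1 ≤ d by omega)
      omega
    · rw [e]
      exact ⟨by simp, by simpa, by simpa, by simp,
        fun a ha => by rw [State.set_mem, if_neg (by omega), h3 a ha], h4⟩
  · rintro τ ⟨h0, h1, h2, h3, h4, h5, h6⟩
    exact ⟨⟨h0, h1, h2, h5⟩, h3, h4, h6⟩

/-- The state after the first `s` indices have been drawn. -/
def Drawn (n d : ℕ) (ω : ℕ → Bool) (inp : List ℕ) (s : ℕ) (σ : State) : Prop :=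
  Base n d σ ∧ (∀ s' < s, σ.mem (20 + s') = sampleIndex ω n s') ∧
    (∀ a, 20 + s ≤ a → σ.mem a = 0) ∧ σ.input = inp ∧ σ.flips = s * (n + 20)

theorem runs_drawProg (hF : F.top = topCell K m) (hA : ∀ t ∈ programTerms K m, F.Adm t)
    (hB : F.B = n + 20 + d ^ d) (hn : 0 < n) {inp : List ℕ} {s : ℕ} (hs : s < 5 * K + m)
    (hσ : Drawn n d F.coins inp s σ) :
    F.Runs (drawProg K m s) (Drawn n d F.coins inp (s + 1)) σ := by
  have htop : 20 + s < F.top := by rw [hF, topCell]; omega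
  obtain ⟨hb, hprev, hzero, hinp, hfl⟩ := hσ
  rw [drawProg, ← hF]
  refine Frame.runs_repeat (N := n + 20) (fun i τ => Base n d τ ∧
    (∀ s' < s, τ.mem (20 + s') = sampleIndex F.coins n s') ∧
    τ.mem (20 + s) = coinNumber F.coins (s * (n + 20)) i % n ∧
    (∀ a, 20 + (s + 1) ≤ a → τ.mem a = 0) ∧ τ.input = inp ∧ τ.flips = s * (n + 20) + i)
    (hA _ (by simp [programTerms])) (hA _ (by simp [programTerms])) (by omega) ?_ (by omega)
    ?_ ?_ ?_ ?_
  · simp [Term.eval, Arith.eval, hb.1]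
  · rintro i τ v ⟨h0, h1, h2, h3, h4⟩
    exact ⟨h0.set (by omega) v, fun s' hs' => by rw [State.set_mem, if_neg (by omega), h1 s' hs'],
      by rw [State.set_mem, if_neg (by omega), h2],
      fun a ha => by rw [State.set_mem, if_neg (by omega), h3 a ha], h4⟩
  · exact ⟨hb, hprev, by rw [hzero _ le_rfl]; simp [coinNumber],
      fun a ha => hzero a (by omega), hinp, by simpa using hfl⟩
  · rintro i hi τ ⟨h0, h1, h2, h3, h4, h5⟩
    refine Frame.runs_seq (Frame.runs_flip (by omega) ?_)
    rw [h5]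
    have e : (flipTerm s).eval
        (State.mem { τ.set 8 (F.coins (s * (n + 20) + i)).toNat with
          flips := s * (n + 20) + i + 1 }) =
        coinNumber F.coins (s * (n + 20)) (i + 1) % n := by
      have e2 : (τ.set 8 (F.coins (s * (n + 20) + i)).toNat).mem (20 + s) =
          coinNumber F.coins (s * (n + 20)) i % n := by
        rw [State.set_mem, if_neg (by omega), h2]
      simp only [flipTerm, Term.eval, Term.eval_mul, Arith.eval, e2]
      simp only [State.set_mem, if_true, h0.1, coinNumber, Nat.reduceEqDiff, if_false]
      simp [Nat.add_mod, Nat.mul_mod]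
    refine Frame.runs_assign (hA _ ?_) (by omega) ?_ ?_
    · simp only [programTerms, List.mem_append, List.mem_map, List.mem_range]
      exact Or.inl (Or.inl (Or.inr ⟨s, hs, rfl⟩))
    · rw [e]
      have := Nat.mod_lt (coinNumber F.coins (s * (n + 20)) (i + 1)) hn
      omega
    · rw [e]
      refine ⟨?_, Base.set (σ := { τ.set 8 _ with flips := _ }) (h0.set (by omega) _)
        (by omega) _, fun s' hs' => ?_, ?_, fun a ha => ?_, h4, ?_⟩
      · rw [State.set_mem, if_neg (by omega)]; simp
      · rw [State.set_mem, if_neg (by omega)]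
        simpa [show 20 + s' ≠ 8 by omega] using h1 s' hs'
      · simp
      · rw [State.set_mem, if_neg (by omega)]
        simpa [show a ≠ 8 by omega] using h3 a ha
      · simp [add_assoc]
  · rintro τ ⟨h0, h1, h2, h3, h4, h5⟩
    refine ⟨h0, fun s' hs' => ?_, h3, h4, by rw [h5]; ring⟩
    rcases Nat.lt_succ_iff_lt_or_eq.1 hs' with h | rfl
    · exact h1 s' h
    · exact h2

/-- The part of the `s`-th sample that has been read after `i` permutations and `j` symbols of the
next one; `r s` is its index. -/
def stored {d : ℕ} (r : ℕ → ℕ) (x : ℕ → Perm (Fin d)) (i j s : ℕ) : ℕ :=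
  if r s < i then enc (x (r s)) else if r s = i then partialEnc (x i) j else 0

theorem stored_succ_zero {r : ℕ → ℕ} {x : ℕ → Perm (Fin d)} (i s : ℕ) :
    stored r x (i + 1) 0 s = stored r x i d s := by
  unfold stored
  rcases lt_trichotomy (r s) i with h | h | h
  · simp [h, show r s < i + 1 by omega]
  · simp [h, partialEnc_self]
  · simp [show ¬ r s < i + 1 by omega, show ¬ r s < i by omega, show r s ≠ i by omega, partialEnc]

theorem stored_lt {r : ℕ → ℕ} {x : ℕ → Perm (Fin d)} (hd : 2 ≤ d) (i s : ℕ) {j : ℕ}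
    (hj : j ≤ d) : stored r x i j s < d ^ d := by
  unfold stored
  split_ifs
  · exact enc_lt _
  · exact partialEnc_lt _ hj
  · positivity

/-- The state in the course of reading. -/
def Reading (K m n d : ℕ) (r : ℕ → ℕ) (x : ℕ → Perm (Fin d)) (i j : ℕ) (σ : State) : Prop :=
  Base n d σ ∧ (∀ s < 5 * K + m, σ.mem (20 + s) = r s) ∧
    (∀ s < 5 * K + m, σ.mem (sampleCell K m s) = stored r x i j s) ∧ σ.mem 5 = i

theorem Reading.set {r : ℕ → ℕ} {x : ℕ → Perm (Fin d)} {i j a : ℕ}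
    (h : Reading K m n d r x i j σ) (ha : 2 < a) (ha' : a < 20) (h5 : a ≠ 5) (v : ℕ) :
    Reading K m n d r x i j (σ.set a v) := by
  refine ⟨h.1.set ha v, fun s hs => ?_, fun s hs => ?_, ?_⟩
  · rw [State.set_mem, if_neg (by omega), h.2.1 s hs]
  · rw [State.set_mem, if_neg (by unfold sampleCell; omega), h.2.2.1 s hs]
  · rw [State.set_mem, if_neg (by omega), h.2.2.2]

theorem runs_symbolProg (hF : F.top = topCell K m) (hA : ∀ t ∈ programTerms K m, F.Adm t)
    (hB : F.B = n + 20 + d ^ d) (hd : 2 ≤ d) {r : ℕ → ℕ} {x : ℕ → Perm (Fin d)} {i j : ℕ}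
    (hj : j < d) {rest : List ℕ} (hσ : Reading K m n d r x i j σ) (h6 : σ.mem 6 = d ^ j)
    (hinp : σ.input = (permWord (x i)).drop j ++ rest) :
    F.Runs (symbolProg K m) (fun τ => Reading K m n d r x i (j + 1) τ ∧ τ.mem 6 = d ^ (j + 1) ∧
      τ.input = (permWord (x i)).drop (j + 1) ++ rest ∧ τ.mem 3 = σ.mem 3 ∧ τ.mem 4 = σ.mem 4)
      σ := by
  have htop : 20 + 2 * (5 * K + m) ≤ F.top := by rw [hF, topCell]; omega
  have hdd : d ≤ d ^ d := Nat.le_self_pow (by omega) _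
  have hlen : j < (permWord (x i)).length := by simpa [permWord] using hj
  have hdrop := List.drop_eq_getElem_cons hlen
  rw [permWord_getElem] at hdrop
  rw [hdrop, List.cons_append] at hinp
  have hdig : digitAt (x i) j < d := by simp [digitAt, hj]
  have hpow : d ^ (j + 1) ≤ d ^ d := Nat.pow_le_pow_right (by omega) (by omega)
  rw [symbolProg, ← hF]
  refine Frame.runs_seq (Frame.runs_read (show 7 < F.top by omega)
    (by rw [hinp]; simp only [List.headD_cons]; omega) ?_)
  simp only [hinp, List.headD_cons, List.tail_cons]
  set rest' := (permWord (x i)).drop (j + 1) ++ rest with hrest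
  set σ' : State := { σ.set 7 (digitAt (x i) j + 1) with input := rest' } with hσ'
  have hR : Reading K m n d r x i j σ' := hσ.set (a := 7) (by omega) (by omega) (by omega) _
  set J : ℕ → State → Prop := fun l τ => Base n d τ ∧ (∀ s < 5 * K + m, τ.mem (20 + s) = r s) ∧
    (∀ s < 5 * K + m, τ.mem (sampleCell K m s) =
      if s < l then stored r x i (j + 1) s else stored r x i j s) ∧ τ.mem 5 = i ∧
    τ.mem 6 = d ^ j ∧ τ.mem 7 = digitAt (x i) j + 1 ∧ τ.input = rest' ∧ τ.mem 3 = σ.mem 3 ∧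
    τ.mem 4 = σ.mem 4 with hJ
  refine Frame.runs_seq ((Frame.runs_seqAll J (5 * K + m) (by omega) ?_ ?_).mono ?_)
  · have h := hR.set (a := 19) (by omega) (by omega) (by omega) 0
    refine ⟨h.1, h.2.1, fun s hs => ?_, h.2.2.2, ?_, ?_, rfl, ?_, ?_⟩
    · rw [h.2.2.1 s hs, if_neg (Nat.not_lt_zero _)]
    · simpa [hσ'] using h6
    · simp [hσ']
    · simp [hσ']
    · simp [hσ']
  · rintro s hs τ ⟨h0, h1, h2, h3, h4, h5, h7, h8, h9⟩
    have e : (storeTerm K m s).eval τ.mem = stored r x i (j + 1) s := by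
      have hx := h2 s hs
      rw [if_neg (lt_irrefl _)] at hx
      simp only [storeTerm, Term.eval, Arith.eval, Term.eval_mul, Term.eval_eq, hx, h1 s hs, h3, h4,
        h5, Nat.add_sub_cancel]
      unfold stored
      rcases lt_trichotomy (r s) i with h | h | h
      · simp [h, h.ne]
      · simp [h, partialEnc, Finset.sum_range_succ]
      · simp [h.ne', not_lt.2 h.le]
    refine Frame.runs_assign (hA _ ?_) (by unfold sampleCell; omega) ?_ ?_
    · simp only [programTerms, List.mem_append, List.mem_map, List.mem_range]
      exact Or.inl (Or.inr ⟨s, hs, rfl⟩)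
    · rw [e]
      have := stored_lt (r := r) (x := x) hd i s (show j + 1 ≤ d by omega)
      omega
    · rw [e]
      have hne : ∀ a, a < 20 + (5 * K + m) → a ≠ sampleCell K m s := fun a ha => by
        unfold sampleCell; omega
      refine ⟨h0.set (by unfold sampleCell; omega) _, fun s' hs' => ?_, fun s' hs' => ?_, ?_, ?_,
        ?_, h7, ?_, ?_⟩
      · rw [State.set_mem, if_neg (hne _ (by omega)), h1 s' hs']
      · rw [State.set_mem]
        by_cases hss : s' = s
        · subst hss; simp
        · rw [if_neg (by unfold sampleCell; omega), h2 s' hs']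
          refine if_congr ?_ rfl rfl
          omega
      all_goals rw [State.set_mem, if_neg (hne _ (by omega))]; assumption
  · rintro τ ⟨h0, h1, h2, h3, h4, h5, h7, h8, h9⟩
    have e : (mul (var 6) (var 1)).eval τ.mem = d ^ (j + 1) := by
      rw [Term.eval_mul]; simp [Term.eval, h4, h0.2.1, pow_succ]
    refine Frame.runs_assign (hA _ (by simp [programTerms])) (by omega) (by omega) ?_
    rw [e]
    refine ⟨Reading.set ⟨h0, h1, fun s hs => ?_, h3⟩ (by omega) (by omega) (by omega) _, by simp,
      h7, by simpa, by simpa⟩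
    rw [h2 s hs, if_pos hs]

theorem runs_permProg (hF : F.top = topCell K m) (hA : ∀ t ∈ programTerms K m, F.Adm t)
    (hB : F.B = n + 20 + d ^ d) (hd : 2 ≤ d) {r : ℕ → ℕ} {x : ℕ → Perm (Fin d)} {i : ℕ}
    (hi : i < n) {rest : List ℕ} (hσ : Reading K m n d r x i 0 σ)
    (hinp : σ.input = permWord (x i) ++ rest) :
    F.Runs (permProg K m) (fun τ => Reading K m n d r x (i + 1) 0 τ ∧ τ.input = rest ∧
      τ.mem 3 = σ.mem 3) σ := by
  have htop : 20 + 2 * (5 * K + m) ≤ F.top := by rw [hF, topCell]; omega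
  have hdd : d ≤ d ^ d := Nat.le_self_pow (by omega) _
  rw [permProg, ← hF]
  refine Frame.runs_seq (Frame.runs_const (by omega) (by omega) (Frame.runs_seq ?_))
  refine Frame.runs_repeat (N := d) (fun j τ => Reading K m n d r x i j τ ∧ τ.mem 6 = d ^ j ∧
    τ.input = (permWord (x i)).drop j ++ rest ∧ τ.mem 3 = σ.mem 3)
    (hA _ (by simp [programTerms])) (hA _ (by simp [programTerms])) (by omega) ?_ (by omega)
    ?_ ?_ ?_ ?_
  · simp [Term.eval, hσ.1.2.1]
  · rintro j τ v ⟨h0, h1, h2, h3⟩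
    exact ⟨h0.set (by omega) (by omega) (by omega) v, by simpa, h2, by simpa⟩
  · exact ⟨hσ.set (by omega) (by omega) (by omega) _, by simp, by simpa, by simp⟩
  · rintro j hj τ ⟨h0, h1, h2, h3⟩
    exact (runs_symbolProg hF hA hB hd hj h0 h1 h2).mono fun υ ⟨g0, g1, g2, g3, g4⟩ =>
      ⟨g4, g0, g1, g2, g3.trans h3⟩
  · rintro τ ⟨h0, h1, h2, h3⟩
    have e : (arith .add (var 5) (const 1)).eval τ.mem = i + 1 := by
      simp [Term.eval, Arith.eval, h0.2.2.2]
    refine Frame.runs_assign (hA _ (by simp [programTerms])) (by omega) (by omega) ?_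
    rw [e]
    refine ⟨⟨h0.1.set (by omega) _, fun s hs => ?_, fun s hs => ?_, by simp⟩, ?_, by simpa⟩
    · rw [State.set_mem, if_neg (by omega), h0.2.1 s hs]
    · rw [State.set_mem, if_neg (by unfold sampleCell; omega), h0.2.2.1 s hs, stored_succ_zero]
    · have hlen : (permWord (x i)).length ≤ d := by simp [permWord]
      simpa [List.drop_eq_nil_of_le hlen] using h2

/-- All samples have been stored; `z s` is the `s`-th sample. -/
def Stored (K m n d : ℕ) (z : ℕ → Perm (Fin d)) (σ : State) : Prop :=
  Base n d σ ∧ ∀ s < 5 * K + m, σ.mem (sampleCell K m s) = enc (z s)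

theorem runs_readProg (hF : F.top = topCell K m) (hA : ∀ t ∈ programTerms K m, F.Adm t)
    (hB : F.B = n + 20 + d ^ d) (hd : 2 ≤ d) (hn : 0 < n) {x : ℕ → Perm (Fin d)}
    (hσ : Drawn n d F.coins (List.ofFn fun i : Fin n => permWord (x i)).flatten (5 * K + m) σ) :
    F.Runs (readProg K m) (Stored K m n d fun s => x (sampleIndex F.coins n s)) σ := by
  have htop : 20 + 2 * (5 * K + m) ≤ F.top := by rw [hF, topCell]; omega
  have hr : ∀ s, sampleIndex F.coins n s < n := fun s => Nat.mod_lt _ hn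
  obtain ⟨hb, hprev, hzero, hinp, hfl⟩ := hσ
  rw [readProg, ← hF]
  refine Frame.runs_seq (Frame.runs_const (by omega) (by omega) ?_)
  refine Frame.runs_repeat (N := n) (fun i τ =>
    Reading K m n d (sampleIndex F.coins n) x i 0 τ ∧
    τ.input = ((List.ofFn fun i : Fin n => permWord (x i)).drop i).flatten)
    (hA _ (by simp [programTerms])) (hA _ (by simp [programTerms])) (by omega) ?_ (by omega)
    ?_ ?_ ?_ ?_
  · simp [Term.eval, hb.1]
  · rintro i τ v ⟨h0, h1⟩
    exact ⟨h0.set (by omega) (by omega) (by omega) v, h1⟩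
  · refine ⟨⟨hb.set (by omega) _, fun s hs => ?_, fun s hs => ?_, by simp⟩, by simpa using hinp⟩
    · rw [State.set_mem, if_neg (by omega), hprev s hs]
    · rw [State.set_mem, if_neg (by unfold sampleCell; omega),
        hzero _ (by unfold sampleCell; omega)]
      simp [stored, partialEnc]
  · rintro i hi τ ⟨h0, h1⟩
    have hlen : i < (List.ofFn fun i : Fin n => permWord (x i)).length := by simpa using hi
    rw [List.drop_eq_getElem_cons hlen, List.flatten_cons, List.getElem_ofFn] at h1
    exact (runs_permProg hF hA hB hd hi h0 h1).mono fun υ ⟨g0, g1, g2⟩ => ⟨g2, g0, g1⟩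
  · rintro τ ⟨h0, h1⟩
    refine ⟨h0.1, fun s hs => ?_⟩
    rw [h0.2.2.1 s hs, stored, if_pos (hr s)]

theorem runs_writeProg (hF : F.top = topCell K m) (hA : ∀ t ∈ programTerms K m, F.Adm t)
    (hB : F.B = n + 20 + d ^ d) (hd : 2 ≤ d) {y : Perm (Fin d)} (h1 : σ.mem 1 = d)
    (h9 : σ.mem 9 = enc y) (hout : σ.output = []) :
    F.Runs (writeProg K m) (fun τ => τ.output = permWord y) σ := by
  have htop : 20 + 2 * (5 * K + m) ≤ F.top := by rw [hF, topCell]; omega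
  have hdd : d ≤ d ^ d := Nat.le_self_pow (by omega) _
  have hy := enc_lt y
  rw [writeProg, ← hF]
  refine Frame.runs_repeat (N := d) (fun j τ => τ.mem 1 = d ∧ τ.mem 9 = enc y / d ^ j ∧
    τ.output = (permWord y).take j)
    (hA _ (by simp [programTerms])) (hA _ (by simp [programTerms])) (by omega) ?_ (by omega)
    ?_ ?_ ?_ ?_
  · simp [Term.eval, h1]
  · rintro j τ v ⟨g1, g2, g3⟩
    exact ⟨by simpa, by simpa, g3⟩
  · exact ⟨h1, by simpa, by simpa⟩
  · rintro j hj τ ⟨g1, g2, g3⟩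
    have hlen : j < (permWord y).length := by simpa [permWord] using hj
    have e : (arith .add (arith .mod (var 9) (var 1)) (const 1)).eval τ.mem =
        (permWord y)[j] := by
      have := digit_enc y ⟨j, hj⟩
      simp only at this
      simp [Term.eval, Arith.eval, g1, g2, permWord, this]
    have hle : (permWord y)[j] ≤ d := by
      simp only [permWord, List.getElem_ofFn]
      exact (y _).2
    refine Frame.runs_seq (Frame.runs_assign (hA _ (by simp [programTerms])) (by omega)
      (by rw [e]; omega) (Frame.runs_seq (Frame.runs_write (by omega) ?_)))
    rw [e]
    refine Frame.runs_assign (hA _ (by simp [programTerms])) (by omega) ?_ ?_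
    · refine (Nat.div_le_self _ _).trans ?_
      have := Nat.div_le_self (enc y) (d ^ j)
      simp only [Term.eval, State.set_mem, Nat.reduceEqDiff, if_false, g2]
      omega
    · refine ⟨by simp, by simpa, ?_, ?_⟩
      · simp [Term.eval, Arith.eval, g1, g2, Nat.div_div_eq_div_mul, pow_succ]
      · simp only [State.set_output, State.set_mem, if_true, g3]
        rw [List.take_succ_eq_append_getElem hlen]
  · rintro τ ⟨_, _, g3⟩
    rw [g3, List.take_of_length_le (by simp [permWord])]

/-- The program writes the candidate selected from the sampled permutations. -/
theorem runs_program (hF : F.top = topCell K m) (hA : ∀ t ∈ programTerms K m, F.Adm t)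
    (hB : F.B = n + 20 + d ^ d) (hd : 2 ≤ d) (hn : 0 < n) (hK : 0 < K) {x : ℕ → Perm (Fin d)}
    (hσ : σ.mem 0 = n ∧ σ.mem 1 = d ∧ (∀ a, 20 ≤ a → σ.mem a = 0) ∧
      σ.input = (List.ofFn fun i : Fin n => permWord (x i)).flatten ∧
      σ.output = [] ∧ σ.flips = 0) :
    F.Runs (program K m) (fun τ => τ.output = permWord (selection
      (fun (g : Fin K) (j : Fin 5) => x (sampleIndex F.coins n (5 * g + j)))
      (fun j : Fin m => x (sampleIndex F.coins n (5 * K + j))))) σ := by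
  have htop : 20 + 2 * (5 * K + m) ≤ F.top := by rw [hF, topCell]; omega
  refine Frame.runs_seq ((runs_powerProg hF hA hB hd hσ).mono ?_)
  rintro τ₁ ⟨hb, hz, hin, hfl⟩
  refine Frame.runs_seq ((Frame.runs_seqAll (Drawn n d F.coins
    (List.ofFn fun i : Fin n => permWord (x i)).flatten) (5 * K + m) (by omega) ?_
    fun s hs τ hτ => runs_drawProg hF hA hB hn hs hτ).mono fun τ₂ h₂ => ?_)
  · refine ⟨hb.set (by omega) _, fun s' hs' => absurd hs' (Nat.not_lt_zero _), fun a ha => ?_, hin,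
      by simpa using hfl⟩
    rw [State.set_mem, if_neg (by omega), hz a (by omega)]
  refine Frame.runs_seq ((runs_readProg hF hA hB hd hn h₂).mono fun τ₃ h₃ => ?_)
  set z : ℕ → Perm (Fin d) := fun s => x (sampleIndex F.coins n s) with hz
  rw [← hF]
  refine Frame.runs_seq ((Frame.runs_seqAll (fun g τ => Stored K m n d z τ ∧
    ∀ g' < g, τ.mem (medianCell K m g') = enc (median fun j : Fin 5 => z (5 * g' + j))) K
    (by omega) ?_ ?_).mono ?_)
  · refine ⟨⟨h₃.1.set (by omega) _, fun s hs => ?_⟩, fun g hg => absurd hg (Nat.not_lt_zero _)⟩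
    rw [State.set_mem, if_neg (by unfold sampleCell; omega), h₃.2 s hs]
  · rintro g hg τ ⟨⟨h0, h1⟩, h2⟩
    have e : (groupMedianTerm K m g).eval τ.mem =
        enc (median fun j : Fin 5 => z (5 * g + j)) :=
      Term.eval_medianTerm hd h0.2.1 h0.2.2.1 (fun j => by unfold sampleCell; omega)
        fun j => h1 _ (by omega)
    refine Frame.runs_assign (hA _ ?_) (by rw [hF]; unfold medianCell topCell; omega) ?_ ?_
    · simp only [programTerms, List.mem_append, List.mem_map, List.mem_range]
      exact Or.inr ⟨g, hg, rfl⟩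
    · rw [e]
      have := enc_lt (median fun j : Fin 5 => z (5 * g + j))
      omega
    · rw [e]
      refine ⟨⟨h0.set (by unfold medianCell; omega) _, fun s hs => ?_⟩, fun g' hg' => ?_⟩
      · rw [State.set_mem, if_neg (by unfold sampleCell medianCell; omega), h1 s hs]
      · rw [State.set_mem]
        by_cases hgg : g' = g
        · subst hgg; simp
        · rw [if_neg (by unfold medianCell; omega), h2 g' (by omega)]
  · rintro τ ⟨⟨h0, h1⟩, h2⟩
    have hcand : ∀ (g : Fin K) (b : Bool),
        τ.mem (if b then medianCell K m g else sampleCell K m (5 * g)) =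
        enc (candidate median (fun (g : Fin K) (j : Fin 5) => z (5 * g + j)) (g, b)) := by
      intro g b
      cases b
      · simpa [candidate] using h1 (5 * g) (by omega)
      · simpa [candidate] using h2 g g.2
    have e : (selectionTerm K m).eval τ.mem = enc (selection
        (fun (g : Fin K) (j : Fin 5) => z (5 * g + j)) (fun j : Fin m => z (5 * K + j))) := by
      refine Term.eval_selectTerm hd h0.2.1 h0.2.2.1 hK (fun j => by unfold sampleCell; omega)
        (fun j => h1 _ (by omega)) (fun a ha => ?_) fun c => ?_
      · simp only [candidateCells, List.mem_append, List.mem_ofFn] at ha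
        rcases ha with ⟨g, rfl⟩ | ⟨g, rfl⟩
        · exact ⟨by unfold sampleCell; omega, (g, false), by simpa using hcand g false⟩
        · exact ⟨by unfold medianCell; omega, (g, true), by simpa using hcand g true⟩
      · obtain ⟨g, b⟩ := c
        refine ⟨_, ?_, hcand g b⟩
        simp only [candidateCells, List.mem_append, List.mem_ofFn]
        cases b
        · exact Or.inl ⟨g, by simp⟩
        · exact Or.inr ⟨g, by simp⟩
    refine Frame.runs_seq (Frame.runs_assign (hA _ (by simp [programTerms])) (by omega) ?_ ?_)
    · rw [e]
      have := enc_lt (selection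
        (fun (g : Fin K) (j : Fin 5) => z (5 * g + j)) (fun j : Fin m => z (5 * K + j)))
      omega
    · rw [e]
      have hb' := h0.set (show 2 < 9 by omega) (enc (selection
        (fun (g : Fin K) (j : Fin 5) => z (5 * g + j)) (fun j : Fin m => z (5 * K + j))))
      exact runs_writeProg hF hA hB hd hb'.2.1 (by simp [hz]) hb'.2.2.2

end Correctness

end StreamRAM

namespace StreamRAM

open UlamMedian
open Equiv (Perm)

/-! ### Resources of the program -/

namespace Term

section Below

variable {k a b : ℕ} {t u : Term}

theorem below_lt (ht : t.Below k) (hu : u.Below k) : (lt t u).Below k :=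
  ⟨trivial, trivial, hu, ht⟩

theorem below_eq (ht : t.Below k) (hu : u.Below k) : (eq t u).Below k :=
  ⟨trivial, ⟨ht, hu⟩, hu, ht⟩

theorem below_mul (ht : t.Below k) (hu : u.Below k) : (mul t u).Below k := ⟨ht, hu⟩

theorem below_none {v : ℕ} (hv : v < k) (ht : t.Below k) (hu : u.Below k) :
    (none v t u).Below k :=
  below_eq ⟨hv, ht, hu⟩ trivial

theorem below_sumList {l : List Term} (h : ∀ t ∈ l, t.Below k) : (sumList l).Below k := by
  induction l with
  | nil => trivial
  | cons t l ih =>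
    exact ⟨h t (by simp), ih fun t ht => h t (by simp [ht])⟩

theorem below_digit (hk : 20 ≤ k) (ha : a < k) (hb : b < k) : (digit a b).Below k :=
  have h1 : 1 < k := by omega
  ⟨⟨ha, h1, hb⟩, h1⟩

theorem below_isPerm (hk : 20 ≤ k) (ha : a < k) : (isPerm a).Below k :=
  have h : ∀ c, c < 20 → c < k := fun c hc => by omega
  below_none (h _ (by norm_num)) (h _ (by norm_num)) ⟨h _ (by norm_num), h _ (by norm_num),
    below_mul (below_lt (h _ (by norm_num)) (h _ (by norm_num)))
      (below_eq (below_digit hk ha (h _ (by norm_num))) (below_digit hk ha (h _ (by norm_num))))⟩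

theorem below_ulam (hk : 20 ≤ k) (ha : a < k) (hb : b < k) : (ulam a b).Below k := by
  have h : ∀ c, c < 20 → c < k := fun c hc => by omega
  have hv : ∀ c, c < 20 → (var c).Below k := fun c hc => h c hc
  have hd : ∀ a c, a < k → c < 20 → (digit a c).Below k := fun a c ha hc =>
    below_digit hk ha (h c hc)
  have hag : (agree a b 14).Below k := by
    refine below_none (h _ (by norm_num)) (hv _ (by norm_num)) ⟨h _ (by norm_num),
      hv _ (by norm_num), h _ (by norm_num), hv _ (by norm_num), h _ (by norm_num),
      hv _ (by norm_num), ?_⟩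
    refine below_mul (below_lt (hv _ (by norm_num)) (hv _ (by norm_num))) (below_mul
      (below_eq (hd _ _ ha (by norm_num)) (hd _ _ hb (by norm_num))) (below_mul
      (below_eq (hd _ _ ha (by norm_num)) (hd _ _ hb (by norm_num))) (below_mul
      (below_lt (hv _ (by norm_num)) (hv _ (by norm_num))) (below_mul
      (below_eq (hd _ _ (h _ (by norm_num)) (by norm_num)) trivial)
      (below_eq (hd _ _ (h _ (by norm_num)) (by norm_num)) trivial)))))
  have hw : (weight 14).Below k := ⟨h _ (by norm_num), hv _ (by norm_num),
    below_lt trivial (hd _ _ (h _ (by norm_num)) (by norm_num))⟩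
  exact ⟨h _ (by norm_num), hv _ (by norm_num), below_none (h _ (by norm_num))
    (hv _ (by norm_num)) (below_mul hag (below_lt hw ⟨hv _ (by norm_num), trivial⟩))⟩

theorem below_cost (hk : 20 ≤ k) {l : ℕ} {f : Fin l → ℕ} (hf : ∀ j, f j < k) (ha : a < k) :
    (cost f a).Below k := by
  refine below_sumList fun t ht => ?_
  obtain ⟨j, rfl⟩ := List.mem_ofFn.1 ht
  exact below_ulam hk (hf j) ha

theorem below_least (hk : 20 ≤ k) (ht : t.Below k) : (least 17 16 (var 2) t).Below k :=
  have h : ∀ c, c < 20 → c < k := fun c hc => by omega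
  ⟨h _ (by norm_num), h _ (by norm_num),
    below_none (h _ (by norm_num)) ⟨h _ (by norm_num), trivial⟩ ht⟩

theorem below_medianTerm (hk : 20 ≤ k) {l : ℕ} {f : Fin l → ℕ} (hf : ∀ j, f j < k) :
    (medianTerm f).Below k := by
  have h : ∀ c, c < 20 → c < k := fun c hc => by omega
  exact below_least hk (below_mul (below_isPerm hk (h _ (by norm_num)))
    (below_none (h _ (by norm_num)) (h _ (by norm_num))
      (below_mul (below_isPerm hk (h _ (by norm_num)))
        (below_lt (below_cost hk hf (h _ (by norm_num)))
          (below_cost hk hf (h _ (by norm_num)))))))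

theorem below_selectTerm (hk : 20 ≤ k) {m : ℕ} {f : Fin m → ℕ} (hf : ∀ j, f j < k) {l : List ℕ}
    (hl : ∀ a ∈ l, a < k) : (selectTerm f l).Below k := by
  have h : ∀ c, c < 20 → c < k := fun c hc => by omega
  refine below_least hk (below_mul (below_sumList fun t ht => ?_)
    (below_eq (below_sumList fun t ht => ?_) trivial))
  · obtain ⟨a, ha, rfl⟩ := List.mem_map.1 ht
    exact below_eq (h _ (by norm_num)) (hl a ha)
  · obtain ⟨a, ha, rfl⟩ := List.mem_map.1 ht
    exact below_lt (below_cost hk hf (hl a ha)) (below_cost hk hf (h _ (by norm_num)))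

end Below

end Term

theorem below_of_mem_programTerms (K m : ℕ) : ∀ t ∈ programTerms K m, t.Below (topCell K m) := by
  have hk : 20 ≤ topCell K m := by unfold topCell; omega
  have h : ∀ c, c < 20 → c < topCell K m := fun c hc => by omega
  intro t ht
  simp only [programTerms, List.mem_append, List.mem_cons, List.mem_map, List.mem_range,
    List.not_mem_nil, or_false] at ht
  rcases ht with (((rfl | rfl | rfl | rfl | rfl | rfl | rfl | rfl | rfl | rfl | rfl) |
    ⟨s, hs, rfl⟩) | ⟨s, hs, rfl⟩) | ⟨g, hg, rfl⟩
  · exact h 0 (by norm_num)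
  · exact h 1 (by norm_num)
  · exact ⟨h 2 (by norm_num), h 1 (by norm_num)⟩
  · exact ⟨h 0 (by norm_num), trivial⟩
  · exact ⟨h 6 (by norm_num), h 1 (by norm_num)⟩
  · exact ⟨h 5 (by norm_num), trivial⟩
  · exact ⟨h 3 (by norm_num), trivial⟩
  · exact ⟨h 4 (by norm_num), trivial⟩
  · exact ⟨⟨h 9 (by norm_num), h 1 (by norm_num)⟩, trivial⟩
  · exact ⟨h 9 (by norm_num), h 1 (by norm_num)⟩
  · refine Term.below_selectTerm hk (fun j => by unfold sampleCell topCell; omega) fun a ha => ?_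
    simp only [candidateCells, List.mem_append, List.mem_ofFn] at ha
    rcases ha with ⟨g, rfl⟩ | ⟨g, rfl⟩
    · unfold sampleCell topCell; omega
    · unfold medianCell topCell; omega
  · have hs' : 20 + s < topCell K m := by unfold topCell; omega
    exact ⟨⟨⟨trivial, hs'⟩, h 8 (by norm_num)⟩, h 0 (by norm_num)⟩
  · have hs' : 20 + s < topCell K m := by unfold topCell; omega
    have hs2 : sampleCell K m s < topCell K m := by unfold sampleCell topCell; omega
    exact ⟨hs2, Term.below_eq hs' (h 5 (by norm_num)), ⟨h 7 (by norm_num), trivial⟩,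
      h 6 (by norm_num)⟩
  · exact Term.below_medianTerm hk fun j => by unfold sampleCell topCell; omega

/-- Uniform resources for finitely many terms. -/
theorem exists_resources (top : ℕ) (l : List Term) :
    ∃ A E : ℕ, top < A ∧ 1 ≤ E ∧ ∀ t ∈ l, top + t.width ≤ A ∧ t.degree ≤ E := by
  induction l with
  | nil => exact ⟨top + 1, 1, by omega, le_rfl, by simp⟩
  | cons t l ih =>
    obtain ⟨A, E, hA, hE, h⟩ := ih
    refine ⟨A + t.width, E + t.degree, by omega, by omega, fun u hu => ?_⟩
    rcases List.mem_cons.1 hu with rfl | hu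
    · omega
    · have := h u hu
      omega

/-- The permutations of the stream, continued arbitrarily. -/
def extend {n d : ℕ} (x : Fin n → Perm (Fin d)) (i : ℕ) : Perm (Fin d) :=
  if h : i < n then x ⟨i, h⟩ else 1

theorem extend_val {n d : ℕ} (x : Fin n → Perm (Fin d)) (i : Fin n) : extend x i = x i := by
  simp [extend]

/-- The output of the program as a function of the coins. -/
noncomputable def programOutput (K m : ℕ) {n d : ℕ} (x : Fin n → Perm (Fin d)) (ω : ℕ → Bool) :
    Perm (Fin d) :=
  selection (fun (g : Fin K) (j : Fin 5) => extend x (sampleIndex ω n (5 * g + j)))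
    (fun j : Fin m => extend x (sampleIndex ω n (5 * K + j)))

theorem exists_exec (K m : ℕ) (hK : 0 < K) : ∃ A E : ℕ, ∀ n d : ℕ, 2 ≤ n → 2 ≤ d →
    ∀ (x : Fin n → Perm (Fin d)) (ω : ℕ → Bool), ∃ t s,
      Exec ω (program K m) (Config.init x) t s ∧
        s ≤ spaceBound A ((n + 20 + d ^ d) ^ E) ∧ t.output = permWord (programOutput K m x ω) := by
  obtain ⟨A, E, hA, hE, h⟩ := exists_resources (topCell K m) (programTerms K m)
  refine ⟨A, E, fun n d hn hd x ω => ?_⟩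
  set F : Frame := ⟨topCell K m, A, n + 20 + d ^ d, E, ω, by omega, hE, hA⟩ with hF
  have hAdm : ∀ t ∈ programTerms K m, F.Adm t := fun t ht =>
    ⟨below_of_mem_programTerms K m t ht, h t ht⟩
  have hdd : d ≤ d ^ d := Nat.le_self_pow (by omega) _
  have hmem : ∀ a, (Config.init x).mem a = if a = 0 then n else if a = 1 then d else 0 := by
    intro a
    simp only [Config.init, Finsupp.add_apply, Finsupp.single_apply]
    rcases eq_or_ne a 0 with rfl | h0
    · simp
    · rcases eq_or_ne a 1 with rfl | h1
      · simp
      · simp [h0, h1, h0.symm, h1.symm]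
  have htop : 20 ≤ topCell K m := by unfold topCell; omega
  have hrep : F.Rep (Config.init x)
      ⟨(Config.init x).mem, (Config.init x).input, [], 0⟩ := by
    have hle : ∀ a, (Config.init x).mem a ≤ F.B := fun a => by
      rw [hmem]
      simp only [hF]
      split_ifs <;> omega
    refine ⟨fun a => ⟨(hle a).trans F.B_le, fun ha => ?_⟩, fun a _ => ⟨rfl, hle a⟩, rfl, rfl, rfl⟩
    rw [hmem] at ha
    by_contra hlt
    have : A ≤ a := not_lt.1 hlt
    rw [if_neg (by omega), if_neg (by omega)] at ha
    exact ha rfl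
  have hrun := runs_program (F := F) (K := K) (m := m) (x := extend x) rfl hAdm rfl hd
    (by omega) hK (σ := ⟨(Config.init x).mem, (Config.init x).input, [], 0⟩)
    ⟨by simp [hmem], by simp [hmem], fun a ha => by
      simp only [hmem]; rw [if_neg (by omega), if_neg (by omega)],
      by simp only [extend_val, Config.init], rfl, rfl⟩
  obtain ⟨t, s, he, hs, _, τ, hτ, hout⟩ := hrun _ hrep
  exact ⟨t, s, he, hs, by rw [hτ.2.2.2.1, hout]; rfl⟩

/-- The bit length of the numbers in use is within the claimed space bound. -/
theorem exists_spaceBound_le (A E : ℕ) : ∃ C : ℝ, ∀ n d : ℕ, 2 ≤ n → 2 ≤ d →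
    (spaceBound A ((n + 20 + d ^ d) ^ E) : ℝ) ≤ C * (d * Real.log d * Real.log n ^ 2) := by
  set l : ℝ := Real.log 2 with hl
  have hl0 : 0 < l := Real.log_pos (by norm_num)
  refine ⟨A * ((A.size + 1) * (1 / (2 * l ^ 3)) +
    E * ((6 * l) * (1 / (2 * l ^ 3)) + 1 / (2 * l ^ 2) + 1 / l ^ 2) / l), fun n d hn hd => ?_⟩
  set B : ℕ := n + 20 + d ^ d with hB
  set X : ℝ := d * Real.log d * Real.log n ^ 2 with hX
  have hn' : (2 : ℝ) ≤ n := by exact_mod_cast hn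
  have hd' : (2 : ℝ) ≤ d := by exact_mod_cast hd
  have hln : l ≤ Real.log n := Real.log_le_log (by norm_num) hn'
  have hld : l ≤ Real.log d := Real.log_le_log (by norm_num) hd'
  have hX1 : 1 ≤ 1 / (2 * l ^ 3) * X := by
    rw [div_mul_eq_mul_div, one_mul, le_div_iff₀ (by positivity), one_mul, hX]
    calc 2 * l ^ 3 = 2 * l * l ^ 2 := by ring
      _ ≤ d * Real.log d * Real.log n ^ 2 := by gcongr
  have hXn : Real.log n ≤ 1 / (2 * l ^ 2) * X := by
    rw [div_mul_eq_mul_div, one_mul, le_div_iff₀ (by positivity), hX]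
    calc Real.log n * (2 * l ^ 2) = 2 * l * (Real.log n * l) := by ring
      _ ≤ d * Real.log d * (Real.log n * Real.log n) := by gcongr
      _ = _ := by ring
  have hXd : d * Real.log d ≤ 1 / l ^ 2 * X := by
    rw [div_mul_eq_mul_div, one_mul, le_div_iff₀ (by positivity), hX]
    gcongr
  have hBle : (B : ℝ) ≤ 2 ^ 5 * n * d ^ d := by
    have h4 : 4 ≤ d ^ d := (show 4 = 2 ^ 2 by norm_num) ▸ (Nat.pow_le_pow_left hd 2).trans
      (Nat.pow_le_pow_right (by omega) hd)
    have : B ≤ 2 ^ 5 * n * d ^ d := by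
      rw [hB]
      nlinarith
    exact_mod_cast this
  have hBpos : 0 < B := by omega
  have hlogB : Real.log B ≤ 5 * l + Real.log n + d * Real.log d := by
    refine (Real.log_le_log (by exact_mod_cast hBpos) hBle).trans (le_of_eq ?_)
    rw [Real.log_mul (by positivity) (by positivity), Real.log_mul (by positivity) (by positivity),
      Real.log_pow, Real.log_pow]
    push_cast
    ring
  have hsizeB : (B.size : ℝ) * l ≤ 6 * l + Real.log n + d * Real.log d := by
    have hpos : 0 < B.size := Nat.size_pos.2 hBpos
    have h1 : 2 ^ (B.size - 1) ≤ B := Nat.lt_size.1 (by omega)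
    have h2 : Real.log ((2 : ℝ) ^ (B.size - 1)) ≤ Real.log B :=
      Real.log_le_log (by positivity) (by exact_mod_cast h1)
    rw [Real.log_pow, Nat.cast_sub hpos] at h2
    push_cast at h2
    linarith
  have hsizeB' : (B.size : ℝ) ≤
      ((6 * l) * (1 / (2 * l ^ 3)) + 1 / (2 * l ^ 2) + 1 / l ^ 2) / l * X := by
    rw [div_mul_eq_mul_div, le_div_iff₀ hl0]
    refine hsizeB.trans ?_
    have := mul_le_mul_of_nonneg_left hX1 (show 0 ≤ 6 * l by positivity)
    linarith
  have hsizeV : ((B ^ E).size : ℝ) ≤ 1 + E * B.size := by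
    have : (B ^ E).size ≤ 1 + E * B.size := by
      rw [Nat.size_le]
      calc B ^ E ≤ (2 ^ B.size) ^ E := Nat.pow_le_pow_left (Nat.lt_size_self B).le E
        _ = 2 ^ (E * B.size) := by rw [← pow_mul, mul_comm]
        _ < 2 ^ (1 + E * B.size) := Nat.pow_lt_pow_right (by norm_num) (by omega)
    exact_mod_cast this
  have hmulE := mul_le_mul_of_nonneg_left hsizeB' (show (0 : ℝ) ≤ E by positivity)
  have hmul1 := mul_le_mul_of_nonneg_left hX1 (show (0 : ℝ) ≤ A.size + 1 by positivity)
  have hfin : ((A.size : ℝ) + (B ^ E).size) ≤ ((A.size + 1) * (1 / (2 * l ^ 3)) +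
      E * ((6 * l) * (1 / (2 * l ^ 3)) + 1 / (2 * l ^ 2) + 1 / l ^ 2) / l) * X := by
    calc ((A.size : ℝ) + (B ^ E).size) ≤ (A.size + 1) * 1 + E * B.size := by linarith
      _ ≤ (A.size + 1) * (1 / (2 * l ^ 3) * X) +
          E * (((6 * l) * (1 / (2 * l ^ 3)) + 1 / (2 * l ^ 2) + 1 / l ^ 2) / l * X) :=
        add_le_add hmul1 hmulE
      _ = _ := by ring
  rw [spaceBound]
  push_cast
  calc (A : ℝ) * (A.size + (B ^ E).size) ≤ A * (_ * X) :=
        mul_le_mul_of_nonneg_left hfin (by positivity)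
    _ = _ := by ring

end StreamRAM

namespace StreamRAM

open UlamMedian
open Equiv (Perm)

/-! ### Sampling with coins -/

theorem coinNumber_congr {ω ω' : ℕ → Bool} {a b L : ℕ} (h : ∀ i < L, ω (a + i) = ω' (b + i)) :
    coinNumber ω a L = coinNumber ω' b L := by
  induction L with
  | zero => rfl
  | succ L ih =>
    rw [coinNumber, coinNumber, ih fun i hi => h i (by omega), h L (by omega)]

/-- The number with the given binary digits, most significant digit first. -/
def bitsNumber {L : ℕ} (b : Fin L → Bool) : ℕ :=
  coinNumber (fun i => if h : i < L then b ⟨i, h⟩ else false) 0 L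

theorem bitsNumber_snoc {L : ℕ} (b : Fin L → Bool) (c : Bool) :
    bitsNumber (Fin.snocEquiv (fun _ => Bool) (c, b)) = 2 * bitsNumber b + c.toNat := by
  unfold bitsNumber
  rw [coinNumber]
  congr 1
  · congr 1
    refine coinNumber_congr fun i hi => ?_
    simp only [zero_add, hi, show i < L + 1 by omega, dite_true, Fin.snocEquiv_apply]
    exact Fin.snoc_castSucc (α := fun _ => Bool) c b ⟨i, hi⟩
  · simp only [zero_add, Nat.lt_succ_self, dite_true, Fin.snocEquiv_apply]
    congr 1
    exact Fin.snoc_last (α := fun _ => Bool) c b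

/-- Uniform bits give a uniform number. -/
theorem sum_bitsNumber (L : ℕ) (g : ℕ → ℕ) :
    ∑ b : Fin L → Bool, g (bitsNumber b) = ∑ v ∈ Finset.range (2 ^ L), g v := by
  induction L generalizing g with
  | zero => simp [bitsNumber, coinNumber]
  | succ L ih =>
    have hdouble : ∀ N, ∑ v ∈ Finset.range (2 * N), g v =
        ∑ v ∈ Finset.range N, (g (2 * v) + g (2 * v + 1)) := fun N => by
      induction N with
      | zero => simp
      | succ N ihN =>
        rw [show 2 * (N + 1) = 2 * N + 1 + 1 by ring, Finset.sum_range_succ, Finset.sum_range_succ,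
          ihN, Finset.sum_range_succ]
        ring
    rw [← (Fin.snocEquiv fun _ => Bool).sum_comp, Fintype.sum_prod_type, Finset.sum_comm]
    simp only [bitsNumber_snoc, Fintype.sum_bool, Bool.toNat_true, Bool.toNat_false]
    rw [ih fun v => g (2 * v + 1) + g (2 * v + 0), pow_succ', hdouble]
    exact Finset.sum_congr rfl fun v _ => add_comm _ _

theorem sum_range_mul_mod (n q : ℕ) (h : ℕ → ℕ) :
    ∑ v ∈ Finset.range (n * q), h (v % n) = q * ∑ i ∈ Finset.range n, h i := by
  induction q with
  | zero => simp
  | succ q ih =>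
    rw [Nat.mul_succ, Finset.sum_range_add, ih, Nat.succ_mul]
    congr 1
    refine Finset.sum_congr rfl fun i hi => ?_
    rw [Nat.mul_add_mod, Nat.mod_eq_of_lt (Finset.mem_range.1 hi)]

section Sampling

variable {n d : ℕ}

/-- The family from which the samples are drawn uniformly: strings of `n + 20` bits, reduced
modulo `n` to an index. -/
def bitFamily (x : Fin n → Perm (Fin d)) (b : Fin (n + 20) → Bool) : Perm (Fin d) :=
  extend x (bitsNumber b % n)

/-- Up to rounding, every permutation of the stream occurs equally often in `bitFamily`. -/
theorem totalDist_bitFamily (x : Fin n → Perm (Fin d)) (hn : 0 < n) (y : Perm (Fin d)) :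
    2 ^ (n + 20) / n * medianObj x y ≤ totalDist (bitFamily x) y ∧
      totalDist (bitFamily x) y ≤ (2 ^ (n + 20) / n + 1) * medianObj x y := by
  set q := 2 ^ (n + 20) / n with hq
  have hobj : medianObj x y = ∑ i ∈ Finset.range n, ulamDist (extend x i) y := by
    rw [← Fin.sum_univ_eq_sum_range fun i => ulamDist (extend x i) y]
    simp only [extend_val, medianObj]
  have htot : totalDist (bitFamily x) y =
      ∑ v ∈ Finset.range (2 ^ (n + 20)), ulamDist (extend x (v % n)) y :=
    sum_bitsNumber (n + 20) fun v => ulamDist (extend x (v % n)) y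
  rw [htot, hobj, ← sum_range_mul_mod n _ fun i => ulamDist (extend x i) y,
    ← sum_range_mul_mod n _ fun i => ulamDist (extend x i) y]
  exact ⟨Finset.sum_le_sum_of_subset (Finset.range_mono (Nat.mul_div_le _ _)),
    Finset.sum_le_sum_of_subset (Finset.range_mono (Nat.lt_mul_div_succ _ hn).le)⟩

end Sampling

section Coins

variable {K m L : ℕ}

/-- The blocks of `L` coins that determine the samples of the groups and the test samples. -/
def blocks (K m L : ℕ) (ω : ℕ → Bool) :
    (Fin K → Fin 5 → Fin L → Bool) × (Fin m → Fin L → Bool) :=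
  (fun g j i => ω ((5 * g + j) * L + i), fun j i => ω ((5 * K + j) * L + i))

theorem exists_blocks_eq (p : (Fin K → Fin 5 → Fin L → Bool) × (Fin m → Fin L → Bool)) :
    ∃ ω, blocks K m L ω = p := by
  obtain ⟨γ, T⟩ := p
  refine ⟨fun i => if hL : 0 < L then
      if h : i / L < 5 * K then γ ⟨i / L / 5, by omega⟩ ⟨i / L % 5, by omega⟩
        ⟨i % L, Nat.mod_lt _ hL⟩
      else if h' : i / L - 5 * K < m then T ⟨i / L - 5 * K, h'⟩ ⟨i % L, Nat.mod_lt _ hL⟩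
      else false
    else false, ?_⟩
  have hdiv : ∀ (s : ℕ) (i : Fin L), (s * L + i) / L = s := fun s i => by
    rw [mul_comm, Nat.mul_add_div i.pos, Nat.div_eq_of_lt i.2, add_zero]
  have hmod : ∀ (s : ℕ) (i : Fin L), (s * L + i) % L = i := fun s i => by
    rw [mul_comm, Nat.mul_add_mod, Nat.mod_eq_of_lt i.2]
  refine Prod.ext ?_ ?_
  · funext g j i
    have h1 : 5 * (g : ℕ) + j < 5 * K := by omega
    have h2 : (5 * (g : ℕ) + j) / 5 = g := by omega
    have h3 : (j : ℕ) % 5 = j := by omega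
    simp [blocks, hdiv, hmod, i.pos, h1, h2, h3]
  · funext j i
    simp [blocks, hdiv, hmod, i.pos]

theorem blocks_eq_iff (ω ω' : ℕ → Bool) :
    blocks K m L ω = blocks K m L ω' ↔ ∀ i < (5 * K + m) * L, ω i = ω' i := by
  constructor
  · intro h i hi
    have hL : 0 < L := Nat.pos_of_ne_zero fun h0 => by simp [h0] at hi
    have hs : i / L < 5 * K + m := Nat.div_lt_of_lt_mul (by rwa [mul_comm])
    have hi' : i / L * L + i % L = i := Nat.div_add_mod' i L
    rcases lt_or_ge (i / L) (5 * K) with h5 | h5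
    · have := congrFun (congrFun (congrFun (congrArg Prod.fst h) ⟨i / L / 5, by omega⟩)
        ⟨i / L % 5, by omega⟩) ⟨i % L, Nat.mod_lt _ hL⟩
      simpa only [blocks, Nat.div_add_mod, hi'] using this
    · have := congrFun (congrFun (congrArg Prod.snd h) ⟨i / L - 5 * K, by omega⟩)
        ⟨i % L, Nat.mod_lt _ hL⟩
      simpa only [blocks, Nat.add_sub_cancel' h5, hi'] using this
  · intro h
    have key : ∀ (s : ℕ) (i : Fin L), s < 5 * K + m → ω (s * L + i) = ω' (s * L + i) :=
      fun s i hs => h _ (by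
        calc s * L + i < s * L + L := by have := i.2; omega
          _ = (s + 1) * L := by ring
          _ ≤ (5 * K + m) * L := Nat.mul_le_mul_right _ hs)
    refine Prod.ext ?_ ?_
    · funext g j i
      exact key _ i (by omega)
    · funext j i
      exact key _ i (by omega)

instance : MeasureTheory.IsProbabilityMeasure coinMeasure := by
  unfold coinMeasure; infer_instance

theorem coinMeasure_prefix (c : ℕ → Bool) (N : ℕ) :
    coinMeasure ((Finset.range N : Set ℕ).pi fun i => {c i}) = (2⁻¹ : ENNReal) ^ N := by
  rw [coinMeasure, MeasureTheory.Measure.infinitePi_pi _ fun _ _ => MeasurableSet.singleton _]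
  simp [PMF.uniformOfFintype_apply]

/-- The blocks of coins are independent and uniformly distributed. -/
theorem coinMeasure_blocks
    (S : Finset ((Fin K → Fin 5 → Fin L → Bool) × (Fin m → Fin L → Bool))) :
    coinMeasure.real {ω | blocks K m L ω ∈ S} = S.card /
      Fintype.card ((Fin K → Fin 5 → Fin L → Bool) × (Fin m → Fin L → Bool)) := by
  set N := (5 * K + m) * L with hN
  have hpt : ∀ p, ∃ c : ℕ → Bool, {ω | blocks K m L ω = p} =
      (Finset.range N : Set ℕ).pi fun i => {c i} := fun p => by
    obtain ⟨c, rfl⟩ := exists_blocks_eq p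
    refine ⟨c, Set.ext fun ω => ?_⟩
    simp [blocks_eq_iff, Set.mem_pi, hN]
  have hmeas : ∀ p, MeasurableSet {ω | blocks K m L ω = p} := fun p => by
    obtain ⟨c, hc⟩ := hpt p
    rw [hc]
    exact MeasurableSet.pi (Finset.countable_toSet _) fun _ _ => MeasurableSet.singleton _
  have hreal : ∀ p, coinMeasure.real {ω | blocks K m L ω = p} = 2⁻¹ ^ N := fun p => by
    obtain ⟨c, hc⟩ := hpt p
    rw [hc, MeasureTheory.measureReal_def, coinMeasure_prefix]
    simp
  have hunion : {ω | blocks K m L ω ∈ S} = ⋃ p ∈ S, {ω | blocks K m L ω = p} := by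
    ext ω; simp
  rw [hunion, MeasureTheory.measureReal_biUnion_finset ?_ fun p _ => hmeas p]
  · simp only [hreal, Finset.sum_const, nsmul_eq_mul, Fintype.card_prod, Fintype.card_fun,
      Fintype.card_fin, Fintype.card_bool]
    push_cast
    rw [inv_pow, div_eq_mul_inv, hN]
    congr 2
    ring
  · intro p _ q _ hpq
    exact Set.disjoint_left.2 fun ω hp hq => hpq (hp.symm.trans hq)

end Coins

section Success

variable {K m n d : ℕ}

/-- The output as a function of the blocks of coins. -/
noncomputable def blockOutput (x : Fin n → Perm (Fin d))
    (γ : Fin K → Fin 5 → Fin (n + 20) → Bool) (T : Fin m → Fin (n + 20) → Bool) : Perm (Fin d) :=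
  selection (fun g j => bitFamily x (γ g j)) fun j => bitFamily x (T j)

theorem programOutput_eq (x : Fin n → Perm (Fin d)) (ω : ℕ → Bool) :
    programOutput K m x ω =
      blockOutput x (blocks K m (n + 20) ω).1 (blocks K m (n + 20) ω).2 := by
  have key : ∀ s, sampleIndex ω n s =
      bitsNumber (fun i : Fin (n + 20) => ω (s * (n + 20) + i)) % n := fun s => by
    have : coinNumber ω (s * (n + 20)) (n + 20) =
        bitsNumber (fun i : Fin (n + 20) => ω (s * (n + 20) + i)) :=
      coinNumber_congr fun i hi => by simp only [zero_add, hi, dite_true]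
    rw [sampleIndex, this]
  unfold programOutput blockOutput
  simp only [key, bitFamily, blocks]

/-- A good median of `bitFamily` is a good median of the stream. -/
theorem isApproxMedian_of_le (hn : 0 < n) (x : Fin n → Perm (Fin d)) {y z : Perm (Fin d)}
    (hz : medianObj x z = medianOpt x)
    (h : (totalDist (bitFamily x) y : ℝ) ≤ 1.999 * totalDist (bitFamily x) z) :
    IsApproxMedian 1.9999 x y := by
  set q := 2 ^ (n + 20) / n with hq
  have hq1 : 2 ^ 20 ≤ q := by
    rw [hq, Nat.le_div_iff_mul_le hn, pow_add, mul_comm]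
    exact Nat.mul_le_mul_right _ Nat.lt_two_pow_self.le
  have hq2 : (1048576 : ℝ) ≤ q := by exact_mod_cast hq1
  have h1 : (q : ℝ) * medianObj x y ≤ totalDist (bitFamily x) y := by
    exact_mod_cast (totalDist_bitFamily x hn y).1
  have h2 : (totalDist (bitFamily x) z : ℝ) ≤ (q + 1) * medianObj x z := by
    exact_mod_cast (totalDist_bitFamily x hn z).2
  rw [IsApproxMedian, ← hz]
  have hz0 : (0 : ℝ) ≤ medianObj x z := by positivity
  have h3 : (q + 1 : ℝ) * 1.999 ≤ q * 1.9999 := by linarith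
  have h4 := mul_le_mul_of_nonneg_right h3 hz0
  refine le_of_mul_le_mul_left ?_ (show (0 : ℝ) < q by linarith)
  linarith

theorem le_coinMeasure_success (hn : 0 < n) (hK : 0 < K) (hm : 0 < m) (x : Fin n → Perm (Fin d)) :
    1 - ((99 / 100 : ℝ) ^ K + 2 * K * (250000 / m)) ≤
      coinMeasure.real {ω | IsApproxMedian 1.9999 x (programOutput K m x ω)} := by
  classical
  obtain ⟨z, hz⟩ : ∃ z, medianObj x z = medianOpt x :=
    Nat.sInf_mem (Set.range_nonempty (medianObj x))
  set Pt := (Fin K → Fin 5 → Fin (n + 20) → Bool) × (Fin m → Fin (n + 20) → Bool)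
  set bad : Finset Pt := Finset.univ.filter fun p =>
    1.999 * (totalDist (bitFamily x) z : ℝ) < totalDist (bitFamily x) (blockOutput x p.1 p.2)
    with hbad
  have hcard : (bad.card : ℝ) ≤ ((99 / 100 : ℝ) ^ K + 2 * K * (250000 / m)) * Fintype.card Pt :=
    card_selection_fails_le (bitFamily x) z isMedianFun_median hm (blockOutput x)
      (fun γ T => (selection_spec hK _ _).1) (fun γ T => (selection_spec hK _ _).2)
  have hpos : (0 : ℝ) < Fintype.card Pt := by exact_mod_cast Fintype.card_pos
  calc 1 - ((99 / 100 : ℝ) ^ K + 2 * K * (250000 / m)) ≤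
        ((badᶜ).card : ℝ) / Fintype.card Pt := by
        rw [le_div_iff₀ hpos, Finset.card_compl, Nat.cast_sub (Finset.card_le_univ _)]
        linarith
    _ = coinMeasure.real {ω | blocks K m (n + 20) ω ∈ badᶜ} := (coinMeasure_blocks _).symm
    _ ≤ _ := by
        refine MeasureTheory.measureReal_mono (fun ω hω => ?_)
        have hω' : blocks K m (n + 20) ω ∉ bad := by simpa using hω
        simp only [hbad, Finset.mem_filter, Finset.mem_univ, true_and, not_lt] at hω'
        rw [Set.mem_ofPred_eq, programOutput_eq]
        exact isApproxMedian_of_le hn x hz hω'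

end Success

end StreamRAM

theorem theorem5 :
    ∀ δ : ℝ, 0 < δ → δ < 1 →
      ∃ (p : StreamRAM.Prog) (C : ℝ),
        ∀ n d : ℕ, 2 ≤ n → 2 ≤ d → ∀ x : Fin n → Equiv.Perm (Fin d),
          (∀ ω : ℕ → Bool, ∃ (t : StreamRAM.Config) (m : ℕ),
            StreamRAM.Exec ω p (StreamRAM.Config.init x) t m ∧
              (m : ℝ) ≤ C * (d * Real.log d * Real.log n ^ 2)) ∧
          1 - δ ≤ StreamRAM.coinMeasure.real
            {ω : ℕ → Bool | ∃ (t : StreamRAM.Config) (m : ℕ) (y : Equiv.Perm (Fin d)),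
              StreamRAM.Exec ω p (StreamRAM.Config.init x) t m ∧
                t.output = permWord y ∧ IsApproxMedian 1.9999 x y} := by
  intro δ hδ0 _
  obtain ⟨K', hK'⟩ := exists_pow_lt_of_lt_one (show 0 < δ / 2 by linarith)
    (show (99 / 100 : ℝ) < 1 by norm_num)
  set K := K' + 1 with hKdef
  have hK : (99 / 100 : ℝ) ^ K ≤ δ / 2 :=
    (pow_le_pow_of_le_one (by norm_num) (by norm_num) (Nat.le_succ K')).trans hK'.le
  obtain ⟨m', hm'⟩ := exists_nat_ge (2 * K * 250000 / (δ / 2))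
  set m := m' + 1 with hmdef
  have hm : 2 * K * (250000 / m : ℝ) ≤ δ / 2 := by
    have hm0 : (0 : ℝ) < m := by positivity
    have h1 : 2 * K * 250000 / (δ / 2) ≤ (m : ℝ) := hm'.trans (by simp [hmdef])
    rw [div_le_iff₀ (by linarith)] at h1
    rw [← mul_div_assoc, div_le_iff₀ hm0]
    linarith
  obtain ⟨A, E, hexec⟩ := StreamRAM.exists_exec K m (Nat.succ_pos K')
  obtain ⟨C, hC⟩ := StreamRAM.exists_spaceBound_le A E
  refine ⟨StreamRAM.program K m, C, fun n d hn hd x => ⟨fun ω => ?_, ?_⟩⟩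
  · obtain ⟨t, s, he, hs, _⟩ := hexec n d hn hd x ω
    exact ⟨t, s, he, le_trans (by exact_mod_cast hs) (hC n d hn hd)⟩
  · have h := StreamRAM.le_coinMeasure_success (K := K) (m := m) (by omega) (Nat.succ_pos K')
      (Nat.succ_pos m') x
    refine le_trans (by linarith) (h.trans (MeasureTheory.measureReal_mono fun ω hω => ?_))
    obtain ⟨t, s, he, _, hout⟩ := hexec n d hn hd x ω
    exact ⟨t, s, _, he, hout, hω⟩
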